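/- Let $(V,E)$ be a connected finite graph with a vertex measure $\mu:V\to(0,+\infty)$ and positive symmetric edge weights $w_{xy}=w_{yx}>0$ ($xy\in E$). For $u:V\to\mathbb{R}$ write $$\Delta u(x)=\frac{1}{\mu(x)}\sum_{y\sim x}w_{xy}\,(u(y)-u(x)),\qquad \int_V u\,d\mu=\sum_{x\in V}\mu(x)u(x).$$ Let $X=L^\infty(V)$ be the space of all functions $V\to\mathbb{R}$ with the norm $\|u\|_{L^\infty(V)}=\max_{x\in V}|u(x)|$, let $\lambda\in\mathbb{R}$ and $f:V\to\mathbb{R}$, and define $F:X\to X$ by $$F(u)=-\Delta u+\lambda e^{u}(e^{u}-1)+f.$$ Suppose that $\lambda\int_V f\,d\mu\neq 0$. Then there exists $R_0>0$ such that for all $R\ge R_0$ the Brouwer degree $\deg(F,B_R,0)$ of $F$ on the ball $B_R=\{u\in X:\|u\|_{L^\infty(V)}<R\}$ is defined (that is, $0\notin F(\partial B_R)$), and $$\deg(F,B_R,0)=\begin{cases}1 & \text{if }\lambda>0,\ \int_V f\,d\mu<0,\\ 0 & \text{if }\lambda\int_V f\,d\mu>0,\\ -1 & \text{if }\lambda<0,\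 \int_V f\,d\mu>0.\end{cases}$$ -/

import Mathlib

open scoped ContDiff

noncomputable section

/-- The Laplacian `Δu(x) = (1 / μ(x)) ∑_{y ∼ x} w_{xy} (u(y) - u(x))` of a function on the vertices
of a finite graph with vertex measure `μ` and edge weights `w`. -/
def graphLaplacian {V : Type*} [Fintype V] (G : SimpleGraph V) [DecidableRel G.Adj]
    (μ : V → ℝ) (w : V → V → ℝ) (u : V → ℝ) : V → ℝ :=
  fun x => (1 / μ x) * ∑ y with G.Adj x y, w x y * (u y - u x)

/-- The integral `∫_V u dμ = ∑_x μ(x) u(x)`. -/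
def graphIntegral {V : Type*} [Fintype V] (μ : V → ℝ) (u : V → ℝ) : ℝ :=
  ∑ x, μ x * u x

/-- The Chern-Simons Higgs map `F(u) = -Δu + λ e^u (e^u - 1) + f`. Its domain and codomain `V → ℝ`
carry the supremum norm, so that this space is `L^∞(V)`. -/
def chernSimonsMap {V : Type*} [Fintype V] (G : SimpleGraph V) [DecidableRel G.Adj]
    (μ : V → ℝ) (w : V → V → ℝ) (lam : ℝ) (f : V → ℝ) (u : V → ℝ) : V → ℝ :=
  fun x => -graphLaplacian G μ w u x + lam * Real.exp (u x) * (Real.exp (u x) - 1) + f x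

/-- `g` is a smooth map, `y` is a regular value of `g` on `Ω`, and
`max_{closure Ω} ‖g - f‖ < dist(y, f(∂Ω))`: the last condition is written pointwise, which for
bounded `Ω` and continuous `f` says the same, as `closure Ω` and `∂Ω` are compact, and
which is no condition on `g` when `∂Ω` is empty. -/
structure IsRegularApprox {E : Type*} [NormedAddCommGroup E] [NormedSpace ℝ E]
    (f : E → E) (Ω : Set E) (y : E) (g : E → E) : Prop where
  contDiff : ContDiff ℝ ∞ g
  close : ∀ x ∈ closure Ω, ∀ z ∈ frontier Ω, dist (g x) (f x) < dist y (f z)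
  regular : ∀ x ∈ Ω, g x = y → (fderiv ℝ g x).det ≠ 0

/-- The Brouwer degree `deg(f, Ω, y)` of a map `f` on a finite-dimensional space is defined and
equal to `d`. That is, `Ω` is bounded and open, `f` is continuous on `closure Ω`, `y ∉ f(∂Ω)`, and
`d` is the value of the algebraic count `∑_{x ∈ Ω, g(x) = y} sgn det Dg(x)`, a finite sum, for one
and every smooth map `g` that has `y` as a regular value and is uniformly closer to `f` on
`closure Ω` than the distance from `y` to `f(∂Ω)`. -/
structure HasBrouwerDegree {E : Type*} [NormedAddCommGroup E] [NormedSpace ℝ E]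
    [FiniteDimensional ℝ E] (f : E → E) (Ω : Set E) (y : E) (d : ℤ) : Prop where
  isOpen : IsOpen Ω
  isBounded : Bornology.IsBounded Ω
  continuousOn : ContinuousOn f (closure Ω)
  notMem : y ∉ f '' frontier Ω
  exists_approx : ∃ g, IsRegularApprox f Ω y g
  finite : ∀ g, IsRegularApprox f Ω y g → {x | x ∈ Ω ∧ g x = y}.Finite
  count : ∀ g, IsRegularApprox f Ω y g →
    ∑ᶠ x ∈ {x | x ∈ Ω ∧ g x = y}, (SignType.sign (fderiv ℝ g x).det : ℤ) = d

/-- There is at most one value of the degree. -/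
theorem HasBrouwerDegree.unique {E : Type*} [NormedAddCommGroup E] [NormedSpace ℝ E]
    [FiniteDimensional ℝ E] {f : E → E} {Ω : Set E} {y : E} {d d' : ℤ}
    (h : HasBrouwerDegree f Ω y d) (h' : HasBrouwerDegree f Ω y d') : d = d' := by
  obtain ⟨g, hg⟩ := h.exists_approx
  rw [← h.count g hg, ← h'.count g hg]

end

/-!
The Brouwer degree of a smooth map `g` of `ℝ^n` on a bounded open set `Ω`, avoiding `0` on `∂Ω`, is
computed by the integral `∫_Ω φ(g) det Dg`, where `φ` is a bump function of integral `1` concentrated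
near `0`.

If `0` is a regular value, a change of variables near each of the finitely many zeros turns the
integral into the algebraic count of the zeros (`exists_setIntegral_mul_det_fderiv_eq`). Along an
affine homotopy `g + t v` without zeros on `∂Ω` the integral is constant
(`setIntegral_mul_det_jacobian_add`), since the `t`-derivative of the density `φ(g) det Dg` is the
divergence of the vector field `φ(g) adj(Dg) v`, which vanishes near `∂Ω`. That it is this divergence
is Jacobi's formula for the derivative of a determinant combined with the Piola identity, by which
the columns of `adj(Dg)` are divergence free (`sum_fderiv_adjugate_jacobian`). As every admissible
approximation of `F` is affinely homotopic to `F`, the count of zeros is the same for all of them, and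
may be found from any regular map `h` affinely homotopic to `F` (`hasBrouwerDegree_of_homotopy`).
Approximations exist by Sard's theorem.

For the map `F(u) = -Δu + N(u)` with `N(u) = λ e^u (e^u - 1) + f` everything rests on one bound
(`exists_norm_lt_of_solution`): solutions of `-Δu + τ N(u) = 0` with `∫ N(u) = 0` are bounded
uniformly in `τ ∈ [0, 1]`. The degree on large balls is therefore that of the end point of a suitable
homotopy.

* If `λ ∫ f > 0`, the constant `λ` is added to `f`. The resulting map has no zeros, so the degree
  is `0`.
* If `λ ∫ f < 0`, the nonlinearity `N(u)` is replaced by its mean value. Integrating shows that a zero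
  of `-Δu + (1 - t) N(u) + t mean N(u)` satisfies `∫ N(u) = 0` and `-Δu + (1 - t) N(u) = 0`, so the
  bound applies. At `t = 1` the only zero is the constant `log a`, with `a > 1` determined by
  `λ a (a - 1) = -mean f`. The derivative there is `v ↦ -Δv + k mean v` with `k = λ a (2a - 1)`, whose
  determinant has the sign of `k`, that is, of `λ`: it is `k` times its value at `k = 1`, which is
  positive by positive definiteness.
-/

open MeasureTheory Matrix Topology Set Filter

/-! ### The Jacobian determinant and the Piola identity -/

section Jacobian

variable {ι : Type*} [Fintype ι] [DecidableEq ι]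

/-- The Jacobian matrix `(∂ᵢ gₖ)` of a self-map of `ℝ^ι`, with row index `k` and column index `i`. -/
noncomputable def jacobian (g : (ι → ℝ) → (ι → ℝ)) (x : ι → ℝ) : Matrix ι ι ℝ :=
  Matrix.of fun k i => fderiv ℝ g x (Pi.single i 1) k

theorem jacobian_eq_toMatrix' (g : (ι → ℝ) → (ι → ℝ)) (x : ι → ℝ) :
    jacobian g x = LinearMap.toMatrix' (fderiv ℝ g x : (ι → ℝ) →ₗ[ℝ] (ι → ℝ)) := by
  ext k i
  simp [jacobian, LinearMap.toMatrix'_apply]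

theorem det_jacobian (g : (ι → ℝ) → (ι → ℝ)) (x : ι → ℝ) :
    (jacobian g x).det = (fderiv ℝ g x).det := by
  rw [jacobian_eq_toMatrix', LinearMap.det_toMatrix', ContinuousLinearMap.det]

theorem jacobian_mulVec (g : (ι → ℝ) → (ι → ℝ)) (x v : ι → ℝ) :
    jacobian g x *ᵥ v = fderiv ℝ g x v := by
  rw [jacobian_eq_toMatrix', LinearMap.toMatrix'_mulVec]; rfl

theorem contDiff_jacobian_apply {g : (ι → ℝ) → (ι → ℝ)} {n m : WithTop ℕ∞}
    (hg : ContDiff ℝ n g) (hmn : m + 1 ≤ n) (k i : ι) :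
    ContDiff ℝ m fun x => jacobian g x k i :=
  contDiff_pi.1 ((hg.fderiv_right hmn).clm_apply contDiff_const) k

theorem contDiff_det {X : Type*} [NormedAddCommGroup X] [NormedSpace ℝ X] {n : WithTop ℕ∞}
    {A : X → Matrix ι ι ℝ} (hA : ∀ k i, ContDiff ℝ n fun y => A y k i) :
    ContDiff ℝ n fun y => (A y).det := by
  simp only [Matrix.det_apply]
  exact ContDiff.sum fun σ _ => (contDiff_prod fun i _ => hA _ _).const_smul _

theorem contDiff_adjugate_apply {X : Type*} [NormedAddCommGroup X] [NormedSpace ℝ X]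
    {n : WithTop ℕ∞} {A : X → Matrix ι ι ℝ} (hA : ∀ k i, ContDiff ℝ n fun y => A y k i)
    (i k : ι) : ContDiff ℝ n fun y => (A y).adjugate i k := by
  simp only [Matrix.adjugate_apply]
  refine contDiff_det fun l m => ?_
  by_cases hl : l = k
  · subst hl
    simpa using contDiff_const
  · simpa [Matrix.updateRow_ne hl] using hA l m

/-- Jacobi's formula `d(det A) = tr(adj(A) dA)`. -/
theorem hasFDerivAt_det {X : Type*} [NormedAddCommGroup X] [NormedSpace ℝ X]
    {A : X → Matrix ι ι ℝ} {A' : ι → ι → X →L[ℝ] ℝ} {x : X}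
    (hA : ∀ k i, HasFDerivAt (fun y => A y k i) (A' k i) x) :
    HasFDerivAt (fun y => (A y).det) (∑ k, ∑ i, (A x).adjugate i k • A' k i) x := by
  let f : ContinuousMultilinearMap ℝ (fun _ : ι => ι → ℝ) ℝ :=
    { (Matrix.detRowAlternating (n := ι) (R := ℝ)).toMultilinearMap with
      cont := Continuous.matrix_det (A := fun M : ι → ι → ℝ => (M : Matrix ι ι ℝ)) continuous_id }
  have h1 : HasFDerivAt (fun y => (A y : ι → ι → ℝ))
      (ContinuousLinearMap.pi fun k => ContinuousLinearMap.pi fun i => A' k i) x :=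
    hasFDerivAt_pi.2 fun k => hasFDerivAt_pi.2 fun i => hA k i
  have h2 := (f.hasFDerivAt (A x)).comp x h1
  refine (h2.congr_fderiv ?_)
  refine ContinuousLinearMap.ext fun v => ?_
  refine (f.linearDeriv_apply (A x) (fun k i => A' k i v)).trans ?_
  simp only [_root_.sum_apply, _root_.smul_apply, smul_eq_mul]
  refine Finset.sum_congr rfl fun k _ => ?_
  have h3 : f (Function.update (A x) k fun i => A' k i v)
      = ((A x).updateRow k fun i => A' k i v).det := rfl
  refine h3.trans ?_
  rw [← Matrix.cramer_transpose_apply, Matrix.cramer_eq_adjugate_mulVec, ← Matrix.adjugate_transpose]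
  rfl

/-- The Piola identity: the columns of the adjugate of a Jacobian matrix are divergence free. -/
theorem sum_fderiv_adjugate_jacobian {g : (ι → ℝ) → (ι → ℝ)} (hg : ContDiff ℝ 2 g)
    (x : ι → ℝ) (k : ι) :
    ∑ i, fderiv ℝ (fun y => (jacobian g y).adjugate i k) x (Pi.single i 1) = 0 := by
  set H : ι → ι → ι → ℝ := fun l i m =>
    fderiv ℝ (fderiv ℝ g) x (Pi.single i 1) (Pi.single m 1) l with hH
  have hsymm : ∀ l i m, H l i m = H l m i := fun l i m =>
    congrFun ((hg.contDiffAt (x := x)).isSymmSndFDerivAt (by simp) (Pi.single i 1) (Pi.single m 1)) l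
  have hd : ∀ l m, HasFDerivAt (fun y => jacobian g y l m)
      (fderiv ℝ (fun y => jacobian g y l m) x) x := fun l m =>
    ((contDiff_jacobian_apply hg (m := 1) (by norm_num) l m).differentiable
      (by norm_num) x).hasFDerivAt
  have hval : ∀ l i m, fderiv ℝ (fun y => jacobian g y l m) x (Pi.single i 1) = H l i m := by
    intro l i m
    have h1 : HasFDerivAt (fderiv ℝ g) (fderiv ℝ (fderiv ℝ g) x) x :=
      ((hg.fderiv_right (m := 1) (by norm_num)).differentiable (by norm_num) x).hasFDerivAt
    have h2 := (hasFDerivAt_pi'.1 (h1.clm_apply (hasFDerivAt_const (Pi.single m (1 : ℝ)) x))) l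
    have h3 : fderiv ℝ (fun y => jacobian g y l m) x = _ := h2.fderiv
    rw [h3]
    simp [hH]
  set D : ι → ι → ι → ℝ := fun l i m =>
    (((jacobian g x).updateRow k (Pi.single i 1)).updateRow l (Pi.single m 1)).det with hD
  -- Interchanging two rows changes the sign, while the Hessians `H l` are symmetric.
  have hanti : ∀ l, l ≠ k → ∀ i m, D l i m = - D l m i := by
    intro l hl i m
    have := Matrix.det_permute (Equiv.swap k l)
      (((jacobian g x).updateRow k (Pi.single i 1)).updateRow l (Pi.single m 1))
    rw [Equiv.Perm.sign_swap hl.symm] at this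
    have h2 : (((jacobian g x).updateRow k (Pi.single i 1)).updateRow l
        (Pi.single m 1)).submatrix (Equiv.swap k l) id
        = ((jacobian g x).updateRow k (Pi.single m 1)).updateRow l (Pi.single i 1) := by
      ext a b
      simp only [Matrix.submatrix_apply, Matrix.updateRow_apply, id, Equiv.swap_apply_def]
      grind
    rw [h2] at this
    simp only [hD]
    rw [this]
    simp
  have key : ∀ i, fderiv ℝ (fun y => (jacobian g y).adjugate i k) x (Pi.single i 1)
      = ∑ l, ∑ m, if l = k then 0 else D l i m * H l i m := by
    intro i
    have h1 := hasFDerivAt_det (x := x)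
      (A := fun y => (jacobian g y).updateRow k (Pi.single i 1))
      (A' := fun l m => if l = k then 0 else fderiv ℝ (fun y => jacobian g y l m) x) (by
        intro l m
        by_cases hl : l = k
        · subst hl
          simpa using hasFDerivAt_const _ x
        · simpa [Matrix.updateRow_ne hl, hl] using hd l m)
    simp only [← Matrix.adjugate_apply] at h1
    rw [h1.fderiv]
    simp only [_root_.sum_apply, _root_.smul_apply, smul_eq_mul]
    refine Finset.sum_congr rfl fun l _ => Finset.sum_congr rfl fun m _ => ?_
    by_cases hl : l = k
    · simp [hl]
    · simp [hl, hval, hD, Matrix.adjugate_apply]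
  rw [Finset.sum_congr rfl fun i _ => key i, Finset.sum_comm]
  refine Finset.sum_eq_zero fun l _ => ?_
  by_cases hl : l = k
  · simp [hl]
  · simp only [hl, if_false]
    have h1 : ∑ i, ∑ m, D l i m * H l i m = - ∑ i, ∑ m, D l i m * H l i m := by
      conv_lhs => rw [Finset.sum_comm]
      rw [← Finset.sum_neg_distrib]
      refine Finset.sum_congr rfl fun i _ => ?_
      rw [← Finset.sum_neg_distrib]
      refine Finset.sum_congr rfl fun m _ => ?_
      rw [hanti l hl m i, hsymm l m i]; ring
    linarith

/-- The divergence of the vector field `ρ adj(Dg) v`. By the Piola identity no second derivative of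
`g` appears. -/
theorem sum_fderiv_mul_adjugate_mulVec {g v : (ι → ℝ) → (ι → ℝ)} {ρ : (ι → ℝ) → ℝ}
    (hg : ContDiff ℝ 2 g) {x : ι → ℝ} (hρ : DifferentiableAt ℝ ρ x)
    (hv : DifferentiableAt ℝ v x) :
    ∑ i, fderiv ℝ (fun y => ρ y * ((jacobian g y).adjugate *ᵥ v y) i) x (Pi.single i 1)
      = fderiv ℝ ρ x ((jacobian g x).adjugate *ᵥ v x)
        + ρ x * ∑ k, ∑ i, (jacobian g x).adjugate i k * jacobian v x k i := by
  have hadj : ∀ i k, DifferentiableAt ℝ (fun y => (jacobian g y).adjugate i k) x := fun i k =>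
    (contDiff_adjugate_apply (n := 1)
      (fun a b => contDiff_jacobian_apply hg (by norm_num) a b) i k).differentiable (by norm_num) x
  have hvk : ∀ k, HasFDerivAt (fun y => v y k)
      ((ContinuousLinearMap.proj k).comp (fderiv ℝ v x)) x := fun k =>
    (hasFDerivAt_pi'.1 hv.hasFDerivAt) k
  have h1 : ∀ i, fderiv ℝ (fun y => ρ y * ((jacobian g y).adjugate *ᵥ v y) i) x (Pi.single i 1)
      = fderiv ℝ ρ x (Pi.single i 1) * ((jacobian g x).adjugate *ᵥ v x) i
        + ρ x * ∑ k, (jacobian g x).adjugate i k * jacobian v x k i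
        + ρ x * ∑ k, fderiv ℝ (fun y => (jacobian g y).adjugate i k) x (Pi.single i 1) * v x k := by
    intro i
    have h2 := hρ.hasFDerivAt.mul
      (HasFDerivAt.fun_sum (u := Finset.univ) fun k _ => (hadj i k).hasFDerivAt.mul (hvk k))
    have h3 : fderiv ℝ (fun y => ρ y * ((jacobian g y).adjugate *ᵥ v y) i) x = _ := h2.fderiv
    rw [h3]
    simp only [_root_.add_apply, _root_.smul_apply, smul_eq_mul,
      _root_.sum_apply, ContinuousLinearMap.comp_apply, ContinuousLinearMap.proj_apply,
      Finset.sum_add_distrib, Matrix.mulVec, dotProduct, jacobian, Matrix.of_apply, Pi.mul_apply]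
    simp only [mul_comm (v x _)]
    ring
  rw [Finset.sum_congr rfl fun i _ => h1 i, Finset.sum_add_distrib, Finset.sum_add_distrib]
  have h4 : ∑ i, ρ x * ∑ k, fderiv ℝ (fun y => (jacobian g y).adjugate i k) x (Pi.single i 1)
      * v x k = 0 := by
    rw [← Finset.mul_sum, Finset.sum_comm]
    simp only [← Finset.sum_mul, sum_fderiv_adjugate_jacobian hg, zero_mul, Finset.sum_const_zero,
      mul_zero]
  have h5 : ∑ i, fderiv ℝ ρ x (Pi.single i 1) * ((jacobian g x).adjugate *ᵥ v x) i
      = fderiv ℝ ρ x ((jacobian g x).adjugate *ᵥ v x) := by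
    conv_rhs => rw [pi_eq_sum_univ' ((jacobian g x).adjugate *ᵥ v x)]
    rw [map_sum]
    refine Finset.sum_congr rfl fun i _ => ?_
    rw [map_smul, smul_eq_mul, mul_comm]
  rw [h4, h5, add_zero, ← Finset.mul_sum, Finset.sum_comm]

theorem jacobian_add_smul {g v : (ι → ℝ) → (ι → ℝ)} {x : ι → ℝ} (hg : DifferentiableAt ℝ g x)
    (hv : DifferentiableAt ℝ v x) (s : ℝ) :
    jacobian (g + s • v) x = jacobian g x + s • jacobian v x := by
  ext k i
  simp [jacobian, fderiv_add hg (hv.const_smul s), fderiv_const_smul hv]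

/-- Moving `g` with velocity `v` changes the density `φ(g) det Dg` at the rate given by the
divergence of `φ(g) adj(Dg) v`. -/
theorem hasDerivAt_mul_det_jacobian {g v : (ι → ℝ) → (ι → ℝ)} {φ : (ι → ℝ) → ℝ}
    (hg : ContDiff ℝ 2 g) (hv : ContDiff ℝ 2 v) (hφ : ContDiff ℝ 1 φ) (x : ι → ℝ) (t : ℝ) :
    HasDerivAt (fun s : ℝ => φ (g x + s • v x) * (jacobian (g + s • v) x).det)
      (∑ i, fderiv ℝ (fun y => φ ((g + t • v) y) *
        ((jacobian (g + t • v) y).adjugate *ᵥ v y) i) x (Pi.single i 1)) t := by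
  have hgt : ∀ s : ℝ, ContDiff ℝ 2 (g + s • v) := fun s => hg.add (contDiff_const.smul hv)
  have hdg := (hg.differentiable (by norm_num) x)
  have hdv := (hv.differentiable (by norm_num) x)
  have hφd := hφ.differentiable (by norm_num)
  have hJ : ∀ s : ℝ, jacobian (g + s • v) x = jacobian g x + s • jacobian v x :=
    jacobian_add_smul hdg hdv
  have hgd := (hgt t).differentiable (by norm_num) x
  rw [sum_fderiv_mul_adjugate_mulVec (ρ := fun y => φ ((g + t • v) y)) (hgt t)
    ((hφd _).comp x hgd) hdv]
  have h1 : HasDerivAt (fun s : ℝ => φ (g x + s • v x)) (fderiv ℝ φ (g x + t • v x) (v x)) t := by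
    have h2 : HasDerivAt (fun s : ℝ => g x + s • v x) (v x) t := by
      simpa using ((hasDerivAt_id t).smul_const (v x)).const_add (g x)
    exact (hφd _).hasFDerivAt.comp_hasDerivAt t h2
  have h3 : HasDerivAt (fun s : ℝ => (jacobian (g + s • v) x).det)
      (∑ k, ∑ i, (jacobian (g + t • v) x).adjugate i k * jacobian v x k i) t := by
    have h4 := (hasFDerivAt_det (x := t) (A := fun s : ℝ => jacobian (g + s • v) x)
      (A' := fun k i => ContinuousLinearMap.toSpanSingleton ℝ (jacobian v x k i)) (by
        intro k i
        simp only [hJ, Matrix.add_apply, Matrix.smul_apply]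
        have : HasDerivAt (fun s : ℝ => jacobian g x k i + s • jacobian v x k i)
            (jacobian v x k i) t := by
          simpa using ((hasDerivAt_id t).smul_const (jacobian v x k i)).const_add (jacobian g x k i)
        exact this.hasFDerivAt)).hasDerivAt
    simpa [_root_.sum_apply] using h4
  have h5 := h1.mul h3
  refine h5.congr_deriv ?_
  congr 1
  have h6 : fderiv ℝ (fun y => φ ((g + t • v) y)) x
      = (fderiv ℝ φ ((g + t • v) x)).comp (fderiv ℝ (g + t • v) x) :=
    fderiv_comp x (hφd _) hgd
  rw [h6, ContinuousLinearMap.comp_apply, ← jacobian_mulVec, Matrix.mulVec_mulVec,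
    Matrix.mul_adjugate, Matrix.smul_mulVec, Matrix.one_mulVec, map_smul, smul_eq_mul, mul_comm]
  rfl

end Jacobian

/-! ### Homotopy invariance of the degree integral -/

section Homotopy

variable {ι : Type*} [Fintype ι]

theorem integral_fderiv_apply_eq_zero {p : (ι → ℝ) → ℝ} (hp : ContDiff ℝ 1 p)
    (hc : HasCompactSupport p) (v : ι → ℝ) : ∫ x, fderiv ℝ p x v = 0 := by
  have hi : Integrable p := hp.continuous.integrable_of_hasCompactSupport hc
  have hi' : Integrable fun x => fderiv ℝ p x v :=
    ((hp.continuous_fderiv (by norm_num)).clm_apply continuous_const).integrable_of_hasCompactSupport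
      (hc.fderiv_apply ℝ v)
  have := integral_mul_fderiv_eq_neg_fderiv_mul_of_integrable (μ := volume)
    (f := fun _ : ι → ℝ => (1 : ℝ)) (g := p) (v := v) (by simp) (by simpa using hi')
    (by simpa using hi) (fun x _ => differentiableAt_const _)
    (fun x _ => hp.differentiable (by norm_num) x)
  simpa using this

/-- A function that vanishes near the boundary of a bounded open set may be cut off to that set,
so the integrals of its directional derivatives over the set vanish. -/
theorem setIntegral_fderiv_apply_eq_zero {Ω : Set (ι → ℝ)} (hΩ : IsOpen Ω)
    (hb : Bornology.IsBounded Ω) {p : (ι → ℝ) → ℝ} (hp : ContDiff ℝ 1 p)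
    (h0 : ∀ z ∈ frontier Ω, ∀ᶠ x in 𝓝 z, p x = 0) (v : ι → ℝ) :
    ∫ x in Ω, fderiv ℝ p x v = 0 := by
  have hloc : ∀ x, (x ∈ Ω ∧ Ω.indicator p =ᶠ[𝓝 x] p) ∨
      (Ω.indicator p =ᶠ[𝓝 x] 0 ∧ (x ∈ Ω → p =ᶠ[𝓝 x] 0)) := by
    intro x
    by_cases hx : x ∈ Ω
    · left
      exact ⟨hx, by filter_upwards [hΩ.mem_nhds hx] with y hy using indicator_of_mem hy _⟩
    right
    refine ⟨?_, fun h => absurd h hx⟩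
    by_cases hxc : x ∈ closure Ω
    · have hxf : x ∈ frontier Ω := by rw [hΩ.frontier_eq]; exact ⟨hxc, hx⟩
      filter_upwards [h0 x hxf] with y hy
      by_cases hy' : y ∈ Ω <;> simp [hy', hy]
    · filter_upwards [isClosed_closure.isOpen_compl.mem_nhds hxc] with y hy
      exact indicator_of_notMem (fun h => hy (subset_closure h)) _
  have hq : ContDiff ℝ 1 (Ω.indicator p) := by
    rw [contDiff_iff_contDiffAt]
    intro x
    rcases hloc x with h | h
    · exact hp.contDiffAt.congr_of_eventuallyEq h.2
    · exact contDiffAt_const.congr_of_eventuallyEq h.1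
  have hqd : ∀ x, fderiv ℝ (Ω.indicator p) x v = Ω.indicator (fun y => fderiv ℝ p y v) x := by
    intro x
    rcases hloc x with h | h
    · rw [h.2.fderiv_eq, indicator_of_mem h.1]
    · rw [h.1.fderiv_eq]
      by_cases hx : x ∈ Ω
      · rw [indicator_of_mem hx, (h.2 hx).fderiv_eq]
      · rw [indicator_of_notMem hx]; simp
  have hcs : HasCompactSupport (Ω.indicator p) :=
    HasCompactSupport.intro' hb.isCompact_closure isClosed_closure fun x hx =>
      indicator_of_notMem (fun h => hx (subset_closure h)) _
  rw [← integral_indicator hΩ.measurableSet, ← integral_fderiv_apply_eq_zero hq hcs v]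
  exact integral_congr_ae (Eventually.of_forall fun x => (hqd x).symm)

variable [DecidableEq ι]

/-- Homotopy invariance of the degree integral `∫_Ω φ(g) det Dg`, along an affine homotopy which
stays outside the support of `φ` on the boundary of `Ω`. -/
theorem setIntegral_mul_det_jacobian_add {Ω : Set (ι → ℝ)} (hΩ : IsOpen Ω)
    (hb : Bornology.IsBounded Ω) {g v : (ι → ℝ) → (ι → ℝ)} (hg : ContDiff ℝ 2 g)
    (hv : ContDiff ℝ 2 v) {φ : (ι → ℝ) → ℝ} (hφ : ContDiff ℝ 1 φ) {δ : ℝ}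
    (hφδ : ∀ y, δ ≤ ‖y‖ → φ y = 0)
    (hδ : ∀ t ∈ Icc (0 : ℝ) 1, ∀ z ∈ frontier Ω, δ < ‖g z + t • v z‖) :
    ∫ x in Ω, φ (g x) * (jacobian g x).det
      = ∫ x in Ω, φ (g x + v x) * (jacobian (g + v) x).det := by
  set G : ℝ × (ι → ℝ) → ℝ := fun p =>
    φ (g p.2 + p.1 • v p.2) * (jacobian g p.2 + p.1 • jacobian v p.2).det with hG
  have hGc : ContDiff ℝ 1 G := by
    refine ContDiff.mul (hφ.comp (ContDiff.add ?_ (contDiff_fst.smul ?_)))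
      (contDiff_det fun k i => ?_)
    · exact (hg.of_le (by norm_num)).comp contDiff_snd
    · exact (hv.of_le (by norm_num)).comp contDiff_snd
    · simp only [Matrix.add_apply, Matrix.smul_apply]
      exact ((contDiff_jacobian_apply hg (by norm_num) k i).comp contDiff_snd).add
        (contDiff_fst.smul ((contDiff_jacobian_apply hv (by norm_num) k i).comp contDiff_snd))
  have hJ : ∀ x (s : ℝ), jacobian (g + s • v) x = jacobian g x + s • jacobian v x := fun x s =>
    jacobian_add_smul (hg.differentiable (by norm_num) x) (hv.differentiable (by norm_num) x) s
  have hdG : ∀ x t, HasDerivAt (fun s => G (s, x)) (fderiv ℝ G (t, x) (1, 0)) t := by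
    intro x t
    have h1 : HasDerivAt (fun s : ℝ => (s, x)) ((1 : ℝ), (0 : ι → ℝ)) t :=
      (hasDerivAt_id t).prodMk (hasDerivAt_const t x)
    exact ((hGc.differentiable (by norm_num)) (t, x)).hasFDerivAt.comp_hasDerivAt t h1
  have hcG : Continuous fun p => fderiv ℝ G p (1, 0) :=
    (hGc.continuous_fderiv (by norm_num)).clm_apply continuous_const
  have hint : ∀ {f : (ι → ℝ) → ℝ}, Continuous f → IntegrableOn f Ω := fun hf =>
    (hf.continuousOn.integrableOn_compact hb.isCompact_closure).mono_set subset_closure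
  have hderiv : ∀ t, HasDerivAt (fun s => ∫ x in Ω, G (s, x))
      (∫ x in Ω, fderiv ℝ G (t, x) (1, 0)) t := by
    intro t
    obtain ⟨C, hC⟩ := ((isCompact_Icc (a := t - 1) (b := t + 1)).prod
      hb.isCompact_closure).exists_bound_of_continuousOn hcG.continuousOn
    have hn : Icc (t - 1) (t + 1) ∈ 𝓝 t := Icc_mem_nhds (by linarith) (by linarith)
    have hc : ∀ s, Continuous fun x => G (s, x) := fun s =>
      hGc.continuous.comp (continuous_const.prodMk continuous_id)
    refine (hasDerivAt_integral_of_dominated_loc_of_deriv_le (bound := fun _ => C)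
      (F' := fun s x => fderiv ℝ G (s, x) (1, 0)) hn
      (Eventually.of_forall fun s => (hc s).aestronglyMeasurable) (hint (hc t))
      (hcG.comp (continuous_const.prodMk continuous_id)).aestronglyMeasurable ?_
      (hint continuous_const) (Eventually.of_forall fun x s _ => hdG x s)).2
    refine (ae_restrict_iff' hΩ.measurableSet).2 (Eventually.of_forall fun x hx s hs => ?_)
    exact hC (s, x) ⟨hs, subset_closure hx⟩
  have hzero : ∀ t ∈ Icc (0 : ℝ) 1, ∫ x in Ω, fderiv ℝ G (t, x) (1, 0) = 0 := by
    intro t ht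
    have hgt : ContDiff ℝ 2 (g + t • v) := hg.add (contDiff_const.smul hv)
    have hp : ∀ i, ContDiff ℝ 1 fun y => φ ((g + t • v) y) *
        ((jacobian (g + t • v) y).adjugate *ᵥ v y) i := by
      intro i
      refine (hφ.comp (hgt.of_le (by norm_num))).mul ?_
      simp only [Matrix.mulVec, dotProduct]
      exact ContDiff.sum fun k _ => (contDiff_adjugate_apply
        (fun a b => contDiff_jacobian_apply hgt (by norm_num) a b) i k).mul
        (contDiff_pi.1 (hv.of_le (by norm_num)) k)
    have h1 : ∀ x, fderiv ℝ G (t, x) (1, 0) = ∑ i, fderiv ℝ (fun y => φ ((g + t • v) y) *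
        ((jacobian (g + t • v) y).adjugate *ᵥ v y) i) x (Pi.single i 1) := by
      intro x
      refine (hdG x t).unique ?_
      have := hasDerivAt_mul_det_jacobian hg hv hφ x t
      simpa only [hJ] using this
    simp only [h1]
    rw [integral_finsetSum _ fun i _ => hint
      (((hp i).continuous_fderiv (by norm_num)).clm_apply continuous_const)]
    refine Finset.sum_eq_zero fun i _ => setIntegral_fderiv_apply_eq_zero hΩ hb (hp i) ?_ _
    intro z hz
    have h2 : ∀ᶠ x in 𝓝 z, δ < ‖(g + t • v) x‖ :=
      (hgt.continuous.norm.continuousAt).eventually (lt_mem_nhds (hδ t ht z hz))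
    filter_upwards [h2] with x hx
    rw [hφδ _ hx.le, zero_mul]
  have := constant_of_has_deriv_right_zero (f := fun s => ∫ x in Ω, G (s, x)) (a := 0) (b := 1)
    (fun t _ => (hderiv t).continuousAt.continuousWithinAt)
    (fun t ht => by
      have h := hderiv t
      rw [hzero t ⟨ht.1, ht.2.le⟩] at h
      exact h.hasDerivWithinAt) 1 (by simp)
  have h1 : ∀ x, jacobian (g + v) x = jacobian g x + jacobian v x := fun x => by
    simpa using hJ x 1
  simp only [hG, zero_smul, add_zero, one_smul] at this
  simp only [h1]
  exact this.symm

end Homotopy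

/-! ### The degree integral counts regular zeros -/

section LocalCount

variable {E : Type*} [NormedAddCommGroup E] [NormedSpace ℝ E] [FiniteDimensional ℝ E]

theorem map_nhds_eq_of_det_fderiv_ne_zero {g : E → E} (hg : ContDiff ℝ 1 g) {z : E}
    (hz : (fderiv ℝ g z).det ≠ 0) : map g (𝓝 z) = 𝓝 (g z) := by
  have := FiniteDimensional.complete ℝ E
  have h := hg.contDiffAt.hasStrictFDerivAt (x := z) (by norm_num)
  rw [← ContinuousLinearMap.coe_toContinuousLinearEquivOfDetNeZero _ hz] at h
  exact h.map_nhds_eq_of_equiv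

theorem exists_injOn_sign_det_fderiv {g : E → E} (hg : ContDiff ℝ 1 g) {z : E}
    (hz : (fderiv ℝ g z).det ≠ 0) :
    ∃ U, IsOpen U ∧ z ∈ U ∧ InjOn g U ∧
      ∀ x ∈ U, SignType.sign (fderiv ℝ g x).det = SignType.sign (fderiv ℝ g z).det := by
  have := FiniteDimensional.complete ℝ E
  have h := hg.contDiffAt.hasStrictFDerivAt (x := z) (by norm_num)
  rw [← ContinuousLinearMap.coe_toContinuousLinearEquivOfDetNeZero _ hz] at h
  have hc : Continuous fun x => (fderiv ℝ g x).det :=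
    ContinuousLinearMap.continuous_det.comp (hg.continuous_fderiv (by norm_num))
  have hs : ∀ᶠ x in 𝓝 z, SignType.sign (fderiv ℝ g x).det = SignType.sign (fderiv ℝ g z).det := by
    rcases lt_or_gt_of_ne hz with h0 | h0
    · filter_upwards [hc.continuousAt.eventually (gt_mem_nhds h0)] with x hx
      rw [sign_neg hx, sign_neg h0]
    · filter_upwards [hc.continuousAt.eventually (lt_mem_nhds h0)] with x hx
      rw [sign_pos hx, sign_pos h0]
  obtain ⟨W, hW, hWo, hzW⟩ := eventually_nhds_iff.1 hs
  refine ⟨(h.toOpenPartialHomeomorph g).source ∩ W,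
    (h.toOpenPartialHomeomorph g).open_source.inter hWo,
    ⟨h.mem_toOpenPartialHomeomorph_source, hzW⟩, ?_, fun x hx => hW x hx.2⟩
  exact (h.toOpenPartialHomeomorph g).injOn.mono inter_subset_left

/-- The zeros of a map in a bounded open set are finitely many, if they are all regular and none
lies on the boundary. -/
theorem finite_zeros_of_regular {Ω : Set E} (hΩ : IsOpen Ω) (hb : Bornology.IsBounded Ω)
    {g : E → E} (hg : ContDiff ℝ 1 g) (hreg : ∀ x ∈ Ω, g x = 0 → (fderiv ℝ g x).det ≠ 0)
    (hfr : ∀ z ∈ frontier Ω, g z ≠ 0) : {x | x ∈ Ω ∧ g x = 0}.Finite := by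
  have := FiniteDimensional.proper ℝ E
  have hZ : {x | x ∈ Ω ∧ g x = 0} = closure Ω ∩ g ⁻¹' {0} := by
    ext x
    refine ⟨fun h => ⟨subset_closure h.1, h.2⟩, fun h => ⟨?_, h.2⟩⟩
    by_contra hx
    exact hfr x (by rw [hΩ.frontier_eq]; exact ⟨h.1, hx⟩) h.2
  have hK : IsCompact {x | x ∈ Ω ∧ g x = 0} := by
    rw [hZ]
    exact hb.isCompact_closure.inter_right (isClosed_singleton.preimage hg.continuous)
  have hex : ∀ z ∈ {x | x ∈ Ω ∧ g x = 0}, ∃ U ∈ 𝓝 z, InjOn g U := by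
    intro z hz
    obtain ⟨U, hU, hzU, hinj, -⟩ := exists_injOn_sign_det_fderiv hg (hreg z hz.1 hz.2)
    exact ⟨U, hU.mem_nhds hzU, hinj⟩
  choose! U hU hinj using hex
  obtain ⟨t, htZ, ht⟩ := hK.elim_nhds_subcover U hU
  refine t.finite_toSet.subset fun x hx => ?_
  obtain ⟨z, hz, hxz⟩ := mem_iUnion₂.1 (ht hx)
  have : x = z := hinj z (htZ z hz) hxz (mem_of_mem_nhds (hU z (htZ z hz)))
    (hx.2.trans (htZ z hz).2.symm)
  exact this ▸ hz

variable [MeasurableSpace E] [BorelSpace E] (μ : Measure E) [μ.IsAddHaarMeasure]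

/-- For `φ` concentrated near a regular value `0`, the degree integral `∫_Ω φ(g) det Dg` is the
algebraic count of the zeros of `g` times `∫ φ`: near each zero `g` is a diffeomorphism, and
changing variables gives `± ∫ φ`. -/
theorem exists_setIntegral_mul_det_fderiv_eq {Ω : Set E} (hΩ : IsOpen Ω)
    (hb : Bornology.IsBounded Ω) {g : E → E} (hg : ContDiff ℝ 1 g)
    (hreg : ∀ x ∈ Ω, g x = 0 → (fderiv ℝ g x).det ≠ 0) (hfr : ∀ z ∈ frontier Ω, g z ≠ 0) :
    ∃ ε > 0, ∀ φ : E → ℝ, Continuous φ → (∀ y, ε ≤ ‖y‖ → φ y = 0) →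
      ∫ x in Ω, φ (g x) * (fderiv ℝ g x).det ∂μ
        = ((∑ᶠ x ∈ {x | x ∈ Ω ∧ g x = 0}, (SignType.sign (fderiv ℝ g x).det : ℤ) : ℤ) : ℝ)
          * ∫ y, φ y ∂μ := by
  have := FiniteDimensional.proper ℝ E
  set Z := {x | x ∈ Ω ∧ g x = 0} with hZdef
  have hZ : Z.Finite := finite_zeros_of_regular hΩ hb hg hreg hfr
  have hex : ∀ z ∈ Z, ∃ U, IsOpen U ∧ z ∈ U ∧ InjOn g U ∧
      ∀ x ∈ U, SignType.sign (fderiv ℝ g x).det = SignType.sign (fderiv ℝ g z).det :=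
    fun z hz => exists_injOn_sign_det_fderiv hg (hreg z hz.1 hz.2)
  choose! U hUo hzU hinj hsgn using hex
  obtain ⟨S, hS, hdisj⟩ := hZ.t2_separation
  set W : E → Set E := fun z => U z ∩ S z ∩ Ω with hW
  have hWo : ∀ z ∈ Z, IsOpen (W z) := fun z hz => ((hUo z hz).inter (hS z).2).inter hΩ
  have hzW : ∀ z ∈ Z, z ∈ W z := fun z hz => ⟨⟨hzU z hz, (hS z).1⟩, hz.1⟩
  have hWdisj : Z.PairwiseDisjoint W :=
    hdisj.mono fun z => inter_subset_left.trans inter_subset_right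
  -- Values near `0` are attained once on each `W z`, and nowhere else.
  have himg : ⋂ z ∈ Z, g '' W z ∈ 𝓝 (0 : E) := by
    refine (biInter_mem hZ).2 fun z hz => ?_
    have h1 := map_nhds_eq_of_det_fderiv_ne_zero hg (hreg z hz.1 hz.2)
    rw [hz.2] at h1
    rw [← h1]
    exact image_mem_map ((hWo z hz).mem_nhds (hzW z hz))
  obtain ⟨ε₁, hε₁, hball⟩ := Metric.mem_nhds_iff.1 himg
  have hoff : ∃ ε₂ > 0, ∀ x ∈ closure Ω \ ⋃ z ∈ Z, W z, ε₂ ≤ ‖g x‖ := by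
    have hK : IsCompact (closure Ω \ ⋃ z ∈ Z, W z) :=
      hb.isCompact_closure.diff (isOpen_biUnion hWo)
    rcases (closure Ω \ ⋃ z ∈ Z, W z).eq_empty_or_nonempty with he | hne
    · exact ⟨1, one_pos, by simp [he]⟩
    obtain ⟨x₀, hx₀, hmin⟩ := hK.exists_isMinOn hne hg.continuous.norm.continuousOn
    refine ⟨‖g x₀‖, norm_pos_iff.2 fun h => ?_, fun x hx => hmin hx⟩
    have hx₀Ω : x₀ ∈ Ω := by
      by_contra hn
      exact hfr x₀ (by rw [hΩ.frontier_eq]; exact ⟨hx₀.1, hn⟩) h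
    exact hx₀.2 (mem_biUnion (show x₀ ∈ Z from ⟨hx₀Ω, h⟩) (hzW x₀ ⟨hx₀Ω, h⟩))
  obtain ⟨ε₂, hε₂, hoff⟩ := hoff
  refine ⟨min ε₁ ε₂, lt_min hε₁ hε₂, fun φ hφ hsupp => ?_⟩
  have hcont : Continuous fun x => φ (g x) * (fderiv ℝ g x).det :=
    (hφ.comp hg.continuous).mul
      (ContinuousLinearMap.continuous_det.comp (hg.continuous_fderiv (by norm_num)))
  have hint : IntegrableOn (fun x => φ (g x) * (fderiv ℝ g x).det) Ω μ :=
    (hcont.continuousOn.integrableOn_compact hb.isCompact_closure).mono_set subset_closure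
  have hWΩ : ∀ z, W z ⊆ Ω := fun z => inter_subset_right
  have hone : ∀ z ∈ Z, ∫ x in W z, φ (g x) * (fderiv ℝ g x).det ∂μ
      = (SignType.sign (fderiv ℝ g z).det : ℤ) * ∫ y, φ y ∂μ := by
    intro z hz
    have hWm := (hWo z hz).measurableSet
    have h1 : ∫ y in g '' W z, φ y ∂μ = ∫ y, φ y ∂μ := by
      refine setIntegral_eq_integral_of_forall_compl_eq_zero fun y hy => hsupp y ?_
      by_contra hlt
      have : y ∈ Metric.ball (0 : E) ε₁ := by
        rw [mem_ball_zero_iff]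
        exact (not_le.1 hlt).trans_le (min_le_left _ _)
      exact hy (mem_iInter₂.1 (hball this) z hz)
    rw [← h1, integral_image_eq_integral_abs_det_fderiv_smul μ hWm
      (fun x _ => (hg.differentiable (by norm_num) x).hasFDerivAt.hasFDerivWithinAt)
      ((hinj z hz).mono (inter_subset_left.trans inter_subset_left)), ← integral_const_mul]
    refine setIntegral_congr_fun hWm fun x hx => ?_
    have h2 : ((SignType.sign (fderiv ℝ g z).det : ℤ) : ℝ) * |(fderiv ℝ g x).det|
        = (fderiv ℝ g x).det := by
      rw [← hsgn z hz x hx.1.1]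
      conv_rhs => rw [← sign_mul_abs (fderiv ℝ g x).det]
      rcases lt_trichotomy (fderiv ℝ g x).det 0 with h | h | h <;> simp [h]
    simp only [smul_eq_mul]
    rw [← mul_assoc, h2, mul_comm]
  have hsub : ∫ x in Ω, φ (g x) * (fderiv ℝ g x).det ∂μ
      = ∫ x in ⋃ z ∈ Z, W z, φ (g x) * (fderiv ℝ g x).det ∂μ := by
    refine setIntegral_eq_of_subset_of_forall_sdiff_eq_zero hΩ.measurableSet
      (iUnion₂_subset fun z _ => hWΩ z) fun x hx => ?_
    rw [hsupp (g x) ((min_le_right _ _).trans (hoff x ⟨subset_closure hx.1, hx.2⟩)), zero_mul]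
  rw [hsub, finsum_mem_eq_finite_toFinset_sum _ hZ]
  have hU : (⋃ z ∈ Z, W z) = ⋃ z ∈ hZ.toFinset, W z := by simp
  rw [hU, integral_biUnion_finset _ (fun z hz => (hWo z (hZ.mem_toFinset.1 hz)).measurableSet)
    (by rw [hZ.coe_toFinset]; exact hWdisj) fun z _ => hint.mono_set (hWΩ z)]
  rw [Int.cast_sum, Finset.sum_mul]
  exact Finset.sum_congr rfl fun z hz => hone z (hZ.mem_toFinset.1 hz)

end LocalCount

/-! ### Computing the Brouwer degree by homotopy -/

section Degree

variable {ι : Type*} [Fintype ι]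

/-- Maps joined by an affine homotopy without zeros on the boundary have the same degree integral,
for every `φ` concentrated sufficiently near `0`. -/
theorem exists_setIntegral_mul_det_fderiv_eq_of_homotopy {Ω : Set (ι → ℝ)} (hΩ : IsOpen Ω)
    (hb : Bornology.IsBounded Ω) {g h : (ι → ℝ) → (ι → ℝ)} (hg : ContDiff ℝ 2 g)
    (hh : ContDiff ℝ 2 h)
    (hgh : ∀ t ∈ Icc (0 : ℝ) 1, ∀ z ∈ frontier Ω, g z + t • (h z - g z) ≠ 0) :
    ∃ δ > 0, ∀ φ : (ι → ℝ) → ℝ, ContDiff ℝ 1 φ → (∀ y, δ ≤ ‖y‖ → φ y = 0) →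
      ∫ x in Ω, φ (g x) * (fderiv ℝ g x).det = ∫ x in Ω, φ (h x) * (fderiv ℝ h x).det := by
  classical
  have hδ : ∃ δ > 0, ∀ t ∈ Icc (0 : ℝ) 1, ∀ z ∈ frontier Ω, δ < ‖g z + t • (h z - g z)‖ := by
    have hK : IsCompact (Icc (0 : ℝ) 1 ×ˢ frontier Ω) :=
      isCompact_Icc.prod (hb.isCompact_closure.of_isClosed_subset isClosed_frontier
        frontier_subset_closure)
    have hc : Continuous fun p : ℝ × (ι → ℝ) => ‖g p.2 + p.1 • (h p.2 - g p.2)‖ := by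
      have h1 := hg.continuous
      have h2 := hh.continuous
      fun_prop
    rcases (Icc (0 : ℝ) 1 ×ˢ frontier Ω).eq_empty_or_nonempty with he | hne
    · refine ⟨1, one_pos, fun t ht z hz => ?_⟩
      have : (t, z) ∈ Icc (0 : ℝ) 1 ×ˢ frontier Ω := ⟨ht, hz⟩
      simp [he] at this
    · obtain ⟨p, hp, hmin⟩ := hK.exists_isMinOn hne hc.continuousOn
      have hpos := norm_pos_iff.2 (hgh p.1 hp.1 p.2 hp.2)
      refine ⟨_, half_pos hpos, fun t ht z hz => (half_lt_self hpos).trans_le ?_⟩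
      exact hmin (show (t, z) ∈ Icc (0 : ℝ) 1 ×ˢ frontier Ω from ⟨ht, hz⟩)
  obtain ⟨δ, hδ0, hδ⟩ := hδ
  refine ⟨δ, hδ0, fun φ hφ hφδ => ?_⟩
  have h1 := setIntegral_mul_det_jacobian_add hΩ hb hg (hh.sub hg) hφ hφδ
    (by simpa using hδ)
  have h2 : g + (fun x => h x - g x) = h := by ext; simp
  simpa only [h2, det_jacobian, add_sub_cancel] using h1

/-- Homotopy invariance of the algebraic count of zeros. The intermediate map `F` need not have
`0` as a regular value. -/
theorem finsum_sign_det_eq_of_homotopy {Ω : Set (ι → ℝ)} (hΩ : IsOpen Ω)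
    (hb : Bornology.IsBounded Ω) {g F h : (ι → ℝ) → (ι → ℝ)} (hg : ContDiff ℝ 2 g)
    (hF : ContDiff ℝ 2 F) (hh : ContDiff ℝ 2 h)
    (hgF : ∀ t ∈ Icc (0 : ℝ) 1, ∀ z ∈ frontier Ω, g z + t • (F z - g z) ≠ 0)
    (hFh : ∀ t ∈ Icc (0 : ℝ) 1, ∀ z ∈ frontier Ω, F z + t • (h z - F z) ≠ 0)
    (hgreg : ∀ x ∈ Ω, g x = 0 → (fderiv ℝ g x).det ≠ 0)
    (hhreg : ∀ x ∈ Ω, h x = 0 → (fderiv ℝ h x).det ≠ 0) :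
    ∑ᶠ x ∈ {x | x ∈ Ω ∧ g x = 0}, (SignType.sign (fderiv ℝ g x).det : ℤ)
      = ∑ᶠ x ∈ {x | x ∈ Ω ∧ h x = 0}, (SignType.sign (fderiv ℝ h x).det : ℤ) := by
  obtain ⟨δ₁, h₁, hI₁⟩ := exists_setIntegral_mul_det_fderiv_eq_of_homotopy hΩ hb hg hF hgF
  obtain ⟨δ₂, h₂, hI₂⟩ := exists_setIntegral_mul_det_fderiv_eq_of_homotopy hΩ hb hF hh hFh
  obtain ⟨ε₁, he₁, hJ₁⟩ := exists_setIntegral_mul_det_fderiv_eq (volume : Measure (ι → ℝ)) hΩ hb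
    (hg.of_le (by norm_num)) hgreg (fun z hz => by simpa using hgF 0 (by simp) z hz)
  obtain ⟨ε₂, he₂, hJ₂⟩ := exists_setIntegral_mul_det_fderiv_eq (volume : Measure (ι → ℝ)) hΩ hb
    (hh.of_le (by norm_num)) hhreg (fun z hz => by simpa using hFh 1 (by simp) z hz)
  set r := min (min δ₁ δ₂) (min ε₁ ε₂) with hr
  have hr0 : 0 < r := lt_min (lt_min h₁ h₂) (lt_min he₁ he₂)
  let φ : ContDiffBump (0 : ι → ℝ) := ⟨r / 2, r, half_pos hr0, half_lt_self hr0⟩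
  have hφ : ∀ s, r ≤ s → ∀ y, s ≤ ‖y‖ → φ y = 0 := fun s hs y hy =>
    φ.zero_of_le_dist (by rw [dist_zero_right]; exact hs.trans hy)
  have e₁ := hI₁ φ φ.contDiff (hφ _ ((min_le_left _ _).trans (min_le_left _ _)))
  have e₂ := hI₂ φ φ.contDiff (hφ _ ((min_le_left _ _).trans (min_le_right _ _)))
  have e₃ := hJ₁ φ φ.continuous (hφ _ ((min_le_right _ _).trans (min_le_left _ _)))
  have e₄ := hJ₂ φ φ.continuous (hφ _ ((min_le_right _ _).trans (min_le_right _ _)))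
  rw [e₁, e₂, e₄] at e₃
  exact_mod_cast (mul_right_cancel₀ (φ.integral_pos (μ := volume)).ne' e₃).symm

/-- A smooth map without zeros on the boundary has an approximation with regular value `0`: by
Sard's theorem one may subtract a small regular value of the map itself. -/
theorem exists_isRegularApprox {Ω : Set (ι → ℝ)} (hb : Bornology.IsBounded Ω)
    {F : (ι → ℝ) → (ι → ℝ)} (hF : ContDiff ℝ ∞ F) (hfr : ∀ z ∈ frontier Ω, F z ≠ 0) :
    ∃ g, IsRegularApprox F Ω 0 g := by
  have hr : ∃ r > 0, ∀ z ∈ frontier Ω, r ≤ ‖F z‖ := by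
    have hK : IsCompact (frontier Ω) :=
      hb.isCompact_closure.of_isClosed_subset isClosed_frontier frontier_subset_closure
    rcases (frontier Ω).eq_empty_or_nonempty with he | hne
    · exact ⟨1, one_pos, by simp [he]⟩
    · obtain ⟨p, hp, hmin⟩ := hK.exists_isMinOn hne hF.continuous.norm.continuousOn
      exact ⟨_, norm_pos_iff.2 (hfr p hp), fun z hz => hmin hz⟩
  obtain ⟨r, hr0, hr⟩ := hr
  have hFd : Differentiable ℝ F := hF.differentiable (by norm_num)
  have hsard : volume (F '' {x | (fderiv ℝ F x).det = 0}) = 0 :=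
    addHaar_image_eq_zero_of_det_fderivWithin_eq_zero volume
      (fun x _ => (hFd x).hasFDerivAt.hasFDerivWithinAt) fun x hx => hx
  obtain ⟨c, hc, hcn⟩ : ∃ c ∈ Metric.ball (0 : ι → ℝ) r, c ∉ F '' {x | (fderiv ℝ F x).det = 0} := by
    by_contra! hcon
    exact (Metric.measure_ball_pos volume (0 : ι → ℝ) hr0).ne' (measure_mono_null hcon hsard)
  refine ⟨fun x => F x - c, hF.sub contDiff_const, fun x _ z hz => ?_, fun x _ hx h0 => ?_⟩
  · rw [dist_zero_left, dist_eq_norm, sub_sub_cancel_left, norm_neg]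
    exact (mem_ball_zero_iff.1 hc).trans_le (hr z hz)
  · rw [fderiv_sub_const] at h0
    exact hcn ⟨x, h0, sub_eq_zero.1 hx⟩

/-- The degree of a smooth map `F` may be computed by counting the zeros of a smooth map `h` with
regular value `0` which is joined to `F` by an affine homotopy without zeros on the boundary. -/
theorem hasBrouwerDegree_of_homotopy {Ω : Set (ι → ℝ)} (hΩ : IsOpen Ω)
    (hb : Bornology.IsBounded Ω) {F h : (ι → ℝ) → (ι → ℝ)} (hF : ContDiff ℝ ∞ F)
    (hh : ContDiff ℝ ∞ h)
    (hFh : ∀ t ∈ Icc (0 : ℝ) 1, ∀ z ∈ frontier Ω, F z + t • (h z - F z) ≠ 0)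
    (hreg : ∀ x ∈ Ω, h x = 0 → (fderiv ℝ h x).det ≠ 0) {d : ℤ}
    (hd : ∑ᶠ x ∈ {x | x ∈ Ω ∧ h x = 0}, (SignType.sign (fderiv ℝ h x).det : ℤ) = d) :
    HasBrouwerDegree F Ω 0 d := by
  have h2 : (2 : WithTop ℕ∞) ≤ ∞ := by
    exact WithTop.coe_le_coe.2 (le_top : (2 : ℕ∞) ≤ ⊤)
  have hfr : ∀ z ∈ frontier Ω, F z ≠ 0 := fun z hz => by simpa using hFh 0 (by simp) z hz
  have happ : ∀ g, IsRegularApprox F Ω 0 g →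
      ∀ t ∈ Icc (0 : ℝ) 1, ∀ z ∈ frontier Ω, g z + t • (F z - g z) ≠ 0 := by
    intro g hg t ht z hz h0
    have h1 := hg.close z (frontier_subset_closure hz) z hz
    rw [dist_zero_left, dist_eq_norm] at h1
    have h3 : F z = (1 - t) • (F z - g z) := by
      have : F z = (g z + t • (F z - g z)) + (1 - t) • (F z - g z) := by module
      rwa [h0, zero_add] at this
    have h4 : ‖F z‖ ≤ ‖F z - g z‖ := by
      conv_lhs => rw [h3]
      rw [norm_smul, Real.norm_eq_abs, abs_of_nonneg (by linarith [ht.2])]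
      nlinarith [norm_nonneg (F z - g z), ht.1]
    rw [norm_sub_rev] at h4
    linarith
  refine ⟨hΩ, hb, hF.continuous.continuousOn, ?_, exists_isRegularApprox hb hF hfr, ?_, ?_⟩
  · rintro ⟨z, hz, h0⟩
    exact hfr z hz h0
  · intro g hg
    exact finite_zeros_of_regular hΩ hb (hg.contDiff.of_le (by norm_num)) hg.regular
      (fun z hz => by simpa using happ g hg 0 (by simp) z hz)
  · intro g hg
    rw [← hd]
    exact finsum_sign_det_eq_of_homotopy hΩ hb (hg.contDiff.of_le h2) (hF.of_le h2)
      (hh.of_le h2) (happ g hg) hFh hg.regular hreg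

end Degree

/-! ### The Laplacian of a connected graph -/

section Graph

variable {V : Type*} [Fintype V] (G : SimpleGraph V) [DecidableRel G.Adj] (μ : V → ℝ)
  (w : V → V → ℝ)

/-- The graph Laplacian as a linear map. -/
noncomputable def laplacianLinearMap : (V → ℝ) →ₗ[ℝ] (V → ℝ) where
  toFun := graphLaplacian G μ w
  map_add' u v := by
    ext x
    simp only [graphLaplacian, Pi.add_apply, ← mul_add, ← Finset.sum_add_distrib]
    congr 1
    exact Finset.sum_congr rfl fun y _ => by ring
  map_smul' c u := by
    ext x
    simp only [graphLaplacian, Pi.smul_apply, smul_eq_mul, RingHom.id_apply]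
    simp only [← mul_sub, mul_left_comm _ c, ← Finset.mul_sum]

/-- The mean value `∫_V u dμ / ∫_V 1 dμ` as a linear functional. -/
noncomputable def graphMean : (V → ℝ) →ₗ[ℝ] ℝ where
  toFun u := graphIntegral μ u / ∑ x, μ x
  map_add' u v := by
    simp only [graphIntegral, Pi.add_apply, mul_add, Finset.sum_add_distrib, add_div]
  map_smul' c u := by
    simp only [graphIntegral, Pi.smul_apply, smul_eq_mul, RingHom.id_apply, mul_left_comm _ c,
      ← Finset.mul_sum, mul_div_assoc]

theorem graphMean_apply (u : V → ℝ) : graphMean μ u = graphIntegral μ u / ∑ x, μ x := rfl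

/-- The linear map `u ↦ -Δu + k ū`, where `ū` is the mean value of `u`. -/
noncomputable def negLaplacianAddMean (k : ℝ) : (V → ℝ) →ₗ[ℝ] (V → ℝ) :=
  -laplacianLinearMap G μ w + k • (graphMean μ).smulRight (1 : V → ℝ)

variable {G μ w}

theorem negLaplacianAddMean_apply (k : ℝ) (u : V → ℝ) (x : V) :
    negLaplacianAddMean G μ w k u x = -graphLaplacian G μ w u x + k * graphMean μ u := by
  simp [negLaplacianAddMean, laplacianLinearMap]

/-- Green's formula. -/
theorem two_mul_sum_mul_graphLaplacian (hμ : ∀ x, 0 < μ x)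
    (hw_symm : ∀ x y, G.Adj x y → w x y = w y x) (u v : V → ℝ) :
    2 * ∑ x, μ x * (v x * graphLaplacian G μ w u x)
      = -∑ x, ∑ y with G.Adj x y, w x y * ((u y - u x) * (v y - v x)) := by
  have h1 : ∑ x, μ x * (v x * graphLaplacian G μ w u x)
      = ∑ x, ∑ y, if G.Adj x y then w x y * (u y - u x) * v x else 0 := by
    refine Finset.sum_congr rfl fun x _ => ?_
    rw [graphLaplacian, ← Finset.sum_filter, ← Finset.sum_mul]
    field_simp [(hμ x).ne']
  have h2 : ∑ x, μ x * (v x * graphLaplacian G μ w u x)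
      = ∑ x, ∑ y, if G.Adj x y then w x y * (u x - u y) * v y else 0 := by
    rw [h1, Finset.sum_comm]
    refine Finset.sum_congr rfl fun x _ => Finset.sum_congr rfl fun y _ => ?_
    by_cases h : G.Adj x y
    · rw [if_pos h, if_pos h.symm, hw_symm x y h]
    · rw [if_neg h, if_neg fun h' => h h'.symm]
  rw [two_mul]
  nth_rw 1 [h1]
  rw [h2, ← Finset.sum_add_distrib, ← Finset.sum_neg_distrib]
  refine Finset.sum_congr rfl fun x _ => ?_
  rw [← Finset.sum_add_distrib, ← Finset.sum_neg_distrib, Finset.sum_filter]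
  refine Finset.sum_congr rfl fun y _ => ?_
  split_ifs <;> ring

theorem graphIntegral_graphLaplacian (hμ : ∀ x, 0 < μ x)
    (hw_symm : ∀ x y, G.Adj x y → w x y = w y x) (u : V → ℝ) :
    graphIntegral μ (graphLaplacian G μ w u) = 0 := by
  have := two_mul_sum_mul_graphLaplacian hμ hw_symm u (fun _ => 1)
  simp only [one_mul, sub_self, mul_zero, Finset.sum_const_zero, neg_zero] at this
  rw [graphIntegral]
  linarith

theorem sum_mul_graphLaplacian_self_nonpos (hμ : ∀ x, 0 < μ x)
    (hw_pos : ∀ x y, G.Adj x y → 0 < w x y)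
    (hw_symm : ∀ x y, G.Adj x y → w x y = w y x) (u : V → ℝ) :
    ∑ x, μ x * (u x * graphLaplacian G μ w u x) ≤ 0 := by
  have h1 := two_mul_sum_mul_graphLaplacian hμ hw_symm u u
  have h2 : 0 ≤ ∑ x, ∑ y with G.Adj x y, w x y * ((u y - u x) * (u y - u x)) :=
    Finset.sum_nonneg fun x _ => Finset.sum_nonneg fun y hy =>
      mul_nonneg (hw_pos x y (Finset.mem_filter.1 hy).2).le (mul_self_nonneg _)
  linarith

theorem eq_of_graphLaplacian_eq_zero (hG : G.Connected) (hμ : ∀ x, 0 < μ x)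
    (hw_pos : ∀ x y, G.Adj x y → 0 < w x y) (hw_symm : ∀ x y, G.Adj x y → w x y = w y x)
    {u : V → ℝ} (hu : ∀ x, graphLaplacian G μ w u x = 0) (x y : V) : u x = u y := by
  have h1 := two_mul_sum_mul_graphLaplacian hμ hw_symm u u
  simp only [hu, mul_zero, Finset.sum_const_zero] at h1
  have hnn : ∀ x, ∀ y ∈ Finset.univ.filter (G.Adj x),
      0 ≤ w x y * ((u y - u x) * (u y - u x)) := fun x y hy =>
    mul_nonneg (hw_pos x y (Finset.mem_filter.1 hy).2).le (mul_self_nonneg _)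
  have h2 := (Finset.sum_eq_zero_iff_of_nonneg fun x _ => Finset.sum_nonneg (hnn x)).1
    (neg_eq_zero.1 h1.symm)
  have hadj : ∀ a b, G.Adj a b → u a = u b := by
    intro a b hab
    have h3 := (Finset.sum_eq_zero_iff_of_nonneg (hnn a)).1 (h2 a (Finset.mem_univ _)) b
      (by simpa using hab)
    have h4 := (mul_eq_zero.1 h3).resolve_left (hw_pos a b hab).ne'
    linarith [mul_self_eq_zero.1 h4]
  obtain ⟨p⟩ := hG.preconnected x y
  induction p with
  | nil => rfl
  | cons h _ ih => exact (hadj _ _ h).trans ih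

theorem sum_measure_pos [Nonempty V] (hμ : ∀ x, 0 < μ x) : 0 < ∑ x, μ x :=
  Finset.sum_pos (fun x _ => hμ x) Finset.univ_nonempty

theorem graphMean_const [Nonempty V] (hμ : ∀ x, 0 < μ x) (c : ℝ) :
    graphMean μ (fun _ => c) = c := by
  rw [graphMean_apply, graphIntegral, ← Finset.sum_mul, mul_div_cancel_left₀ _ (sum_measure_pos hμ).ne']

theorem graphLaplacian_const (c : ℝ) (x : V) : graphLaplacian G μ w (fun _ => c) x = 0 := by
  simp [graphLaplacian]

/-- Taking means: `-Δu + τ v + σ = 0` with constant `σ` forces `τ v̄ + σ = 0`. -/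
theorem graphMean_add_eq_zero [Nonempty V] (hμ : ∀ x, 0 < μ x)
    (hw_symm : ∀ x y, G.Adj x y → w x y = w y x) {u v : V → ℝ} {τ σ : ℝ}
    (h : ∀ x, -graphLaplacian G μ w u x + τ * v x + σ = 0) : τ * graphMean μ v + σ = 0 := by
  have h1 : -graphLaplacian G μ w u + τ • v + (fun _ => σ) = 0 := by
    ext x
    simpa using h x
  have h2 := congrArg (graphMean μ) h1
  rw [map_add, map_add, map_neg, map_smul, graphMean_const hμ, map_zero,
    graphMean_apply μ (graphLaplacian G μ w u), graphIntegral_graphLaplacian hμ hw_symm] at h2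
  simpa using h2

theorem negLaplacianAddMean_injective (hG : G.Connected) (hμ : ∀ x, 0 < μ x)
    (hw_pos : ∀ x y, G.Adj x y → 0 < w x y) (hw_symm : ∀ x y, G.Adj x y → w x y = w y x)
    {k : ℝ} (hk : k ≠ 0) : Function.Injective (negLaplacianAddMean G μ w k) := by
  have := hG.nonempty
  rw [← LinearMap.ker_eq_bot, LinearMap.ker_eq_bot']
  intro u hu
  have hx : ∀ x, -graphLaplacian G μ w u x + k * graphMean μ u = 0 := fun x => by
    rw [← negLaplacianAddMean_apply, hu]; rfl
  have hm : graphMean μ u = 0 := by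
    have := graphMean_add_eq_zero (v := 0) (τ := 0) (σ := k * graphMean μ u) hμ hw_symm
      (u := u) (fun x => by simpa using hx x)
    simpa [hk] using this
  have hc := eq_of_graphLaplacian_eq_zero hG hμ hw_pos hw_symm (u := u)
    (fun x => by simpa [hm] using hx x)
  ext x
  have h1 : u = fun _ => u x := funext fun y => hc y x
  rw [h1, graphMean_const hμ] at hm
  simpa using hm

theorem det_negLaplacianAddMean_one_pos (hG : G.Connected) (hμ : ∀ x, 0 < μ x)
    (hw_pos : ∀ x y, G.Adj x y → 0 < w x y) (hw_symm : ∀ x y, G.Adj x y → w x y = w y x) :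
    0 < LinearMap.det (negLaplacianAddMean G μ w 1) := by
  classical
  have := hG.nonempty
  set L := negLaplacianAddMean G μ w 1 with hL
  -- The convex combinations of the identity and `L` are positive definite for `∫ u v dμ`, so their
  -- determinants do not vanish and keep the sign of `det 1`.
  have hne : ∀ s ∈ Icc (0 : ℝ) 1, LinearMap.det ((1 - s) • LinearMap.id + s • L) ≠ 0 := by
    intro s hs h0
    obtain ⟨u, hu, hu0⟩ := (Submodule.ne_bot_iff _).1 (LinearMap.bot_lt_ker_of_det_eq_zero h0).ne'
    have hu1 : ∀ x, (1 - s) * u x + s * (-graphLaplacian G μ w u x + 1 * graphMean μ u) = 0 := by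
      intro x
      rw [← negLaplacianAddMean_apply]
      exact congrFun (LinearMap.mem_ker.1 hu) x
    have h1 : (1 - s) * ∑ x, μ x * (u x * u x)
        + s * (-∑ x, μ x * (u x * graphLaplacian G μ w u x)
          + graphMean μ u * graphMean μ u * ∑ x, μ x) = 0 := by
      have h2 : ∑ x, μ x * u x = graphMean μ u * ∑ x, μ x := by
        rw [graphMean_apply, graphIntegral, div_mul_cancel₀ _ (sum_measure_pos hμ).ne']
      have h3 : graphMean μ u * graphMean μ u * ∑ x, μ x = ∑ x, μ x * u x * graphMean μ u := by
        rw [← Finset.sum_mul, h2]; ring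
      rw [h3, ← Finset.sum_neg_distrib, ← Finset.sum_add_distrib, Finset.mul_sum, Finset.mul_sum,
        ← Finset.sum_add_distrib]
      refine Finset.sum_eq_zero fun x _ => ?_
      linear_combination μ x * u x * hu1 x
    have h2 := sum_mul_graphLaplacian_self_nonpos hμ hw_pos hw_symm u
    have h3 : 0 < ∑ x, μ x * (u x * u x) := by
      obtain ⟨x, hx⟩ := Function.ne_iff.1 hu0
      exact Finset.sum_pos' (fun y _ => mul_nonneg (hμ y).le (mul_self_nonneg _))
        ⟨x, Finset.mem_univ x, mul_pos (hμ x) (mul_self_pos.2 hx)⟩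
    have h4 : 0 ≤ graphMean μ u * graphMean μ u * ∑ x, μ x :=
      mul_nonneg (mul_self_nonneg _) (sum_measure_pos hμ).le
    rcases hs.2.lt_or_eq with hs1 | rfl
    · nlinarith [mul_pos (sub_pos.2 hs1) h3, mul_nonneg hs.1 (by linarith : (0 : ℝ) ≤
        -∑ x, μ x * (u x * graphLaplacian G μ w u x) + graphMean μ u * graphMean μ u * ∑ x, μ x)]
    · refine hu0 (negLaplacianAddMean_injective hG hμ hw_pos hw_symm one_ne_zero ?_)
      rw [map_zero]
      ext x
      rw [negLaplacianAddMean_apply]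
      simpa using hu1 x
  have hc : Continuous fun s : ℝ => LinearMap.det ((1 - s) • LinearMap.id + s • L) := by
    simp only [← LinearMap.det_toMatrix', map_add, map_smul]
    exact Continuous.matrix_det (by fun_prop)
  by_contra hcon
  obtain ⟨s, hs, hs0⟩ := intermediate_value_Icc' zero_le_one hc.continuousOn
    (show (0 : ℝ) ∈ _ by simpa using not_lt.1 hcon)
  exact hne s hs hs0

/-- The mean value is a rank-one perturbation supported on the kernel of `Δ`, so the determinant is
linear in `k`. -/
theorem det_negLaplacianAddMean [Nonempty V] (hμ : ∀ x, 0 < μ x) (k : ℝ) :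
    LinearMap.det (negLaplacianAddMean G μ w k)
      = k * LinearMap.det (negLaplacianAddMean G μ w 1) := by
  have h1 : negLaplacianAddMean G μ w k = negLaplacianAddMean G μ w 1 ∘ₗ
      LinearMap.transvection ((k - 1) • graphMean μ) (1 : V → ℝ) := by
    refine LinearMap.ext fun u => funext fun x => ?_
    have h3 : graphMean μ (1 : V → ℝ) = 1 := graphMean_const hμ 1
    have h4 : graphLaplacian G μ w (1 : V → ℝ) x = 0 := graphLaplacian_const 1 x
    rw [LinearMap.comp_apply, LinearMap.transvection.apply, map_add, map_smul, Pi.add_apply,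
      Pi.smul_apply, negLaplacianAddMean_apply, negLaplacianAddMean_apply,
      negLaplacianAddMean_apply, h3, h4]
    simp only [LinearMap.smul_apply, smul_eq_mul]
    ring
  have h3 : graphMean μ (1 : V → ℝ) = 1 := graphMean_const hμ 1
  rw [h1, LinearMap.det_comp, LinearMap.transvection.det, LinearMap.smul_apply, h3]
  simp [mul_comm]

/-- A function is controlled by its Laplacian up to its mean value. -/
theorem exists_abs_sub_graphMean_le (hG : G.Connected) (hμ : ∀ x, 0 < μ x)
    (hw_pos : ∀ x y, G.Adj x y → 0 < w x y) (hw_symm : ∀ x y, G.Adj x y → w x y = w y x) :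
    ∃ C : ℝ, 0 ≤ C ∧ ∀ (u : V → ℝ) (B : ℝ), (∀ x, |graphLaplacian G μ w u x| ≤ B) →
      ∀ x, |u x - graphMean μ u| ≤ C * B := by
  have := hG.nonempty
  obtain ⟨K, -, hK⟩ := (negLaplacianAddMean G μ w 1).exists_antilipschitzWith
    (LinearMap.ker_eq_bot.2 (negLaplacianAddMean_injective hG hμ hw_pos hw_symm one_ne_zero))
  refine ⟨K, K.2, fun u B hB x => ?_⟩
  have hB0 : 0 ≤ B := (abs_nonneg _).trans (hB x)
  have h1 := hK.le_mul_dist u (fun _ => graphMean μ u)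
  rw [dist_eq_norm, dist_eq_norm, ← map_sub] at h1
  have h2 : ‖negLaplacianAddMean G μ w 1 (u - fun _ => graphMean μ u)‖ ≤ B := by
    refine (pi_norm_le_iff_of_nonneg hB0).2 fun y => ?_
    rw [map_sub, Pi.sub_apply, negLaplacianAddMean_apply, negLaplacianAddMean_apply,
      graphMean_const hμ, graphLaplacian_const]
    simpa using hB y
  have h3 := norm_le_pi_norm (u - fun _ => graphMean μ u) x
  simp only [Pi.sub_apply, Real.norm_eq_abs] at h3
  exact h3.trans (h1.trans (mul_le_mul_of_nonneg_left h2 K.2))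

end Graph

/-! ### The Chern-Simons Higgs map -/

section Bounds

variable {V : Type*} [Fintype V] {G : SimpleGraph V} [DecidableRel G.Adj] {μ : V → ℝ}
  {w : V → V → ℝ}

theorem neg_quarter_le_exp_mul (s : ℝ) : -(1 / 4) ≤ Real.exp s * (Real.exp s - 1) := by
  nlinarith [sq_nonneg (Real.exp s - 1 / 2)]

/-- Uniform bound for the solutions of `-Δu + τ (λ e^u (e^u - 1) + b) = 0`, `τ ∈ [0, 1]`, with
balanced nonlinearity, when `b` is bounded and its integral stays away from `0`. The balance bounds
`e^u` from above, hence `Δu` and the oscillation of `u`; as `∫ b` is not small, `u` cannot be very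
negative everywhere. -/
theorem exists_norm_lt_of_solution (hG : G.Connected) (hμ : ∀ x, 0 < μ x)
    (hw_pos : ∀ x y, G.Adj x y → 0 < w x y) (hw_symm : ∀ x y, G.Adj x y → w x y = w y x)
    {lam M c : ℝ} (hlam : lam ≠ 0) (hc : 0 < c) :
    ∃ R₀ : ℝ, 0 < R₀ ∧ ∀ τ ∈ Icc (0 : ℝ) 1, ∀ b : V → ℝ, (∀ x, |b x| ≤ M) →
      c ≤ |graphIntegral μ b| → ∀ u : V → ℝ,
      (∀ x, -graphLaplacian G μ w u x
        + τ * (lam * Real.exp (u x) * (Real.exp (u x) - 1) + b x) = 0) →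
      graphIntegral μ (fun x => lam * Real.exp (u x) * (Real.exp (u x) - 1) + b x) = 0 →
      ‖u‖ < R₀ := by
  have := hG.nonempty
  obtain ⟨C, hC0, hC⟩ := exists_abs_sub_graphMean_le hG hμ hw_pos hw_symm
  obtain ⟨x₁, hx₁⟩ := Finite.exists_min μ
  set vol := ∑ x, μ x with hvol
  have hvol0 : 0 < vol := sum_measure_pos hμ
  set M' := |M| with hM'
  -- `A` bounds `e^u`, `B` bounds `|Δu|`, and `η` bounds the maximum of `e^u` from below.
  set A := (M' * vol / |lam| + vol / 4) / μ x₁ + 2 with hA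
  have hlam0 : 0 < |lam| := abs_pos.2 hlam
  have hM0 : 0 ≤ M' := abs_nonneg M
  have hm0 := hμ x₁
  have hK0 : 0 ≤ (M' * vol / |lam| + vol / 4) / μ x₁ := by positivity
  have hA2 : 2 ≤ A := by linarith
  set η := c / (|lam| * vol * A) with hη
  have hη0 : 0 < η := by positivity
  set B := |lam| * A ^ 2 + M' with hB
  refine ⟨A + |Real.log η| + 2 * (C * B) + 1, by positivity, ?_⟩
  intro τ hτ b hbM hbc u hu hu0
  have hbM' : ∀ x, |b x| ≤ M' := fun x => (hbM x).trans (le_abs_self M)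
  set S := ∑ x, μ x * (Real.exp (u x) * (Real.exp (u x) - 1)) with hS
  have hbal : lam * S + graphIntegral μ b = 0 := by
    rw [← hu0, hS, graphIntegral, graphIntegral, Finset.mul_sum, ← Finset.sum_add_distrib]
    exact Finset.sum_congr rfl fun x _ => by ring
  have hbalabs : |lam| * |S| = |graphIntegral μ b| := by
    rw [← abs_mul, eq_neg_of_add_eq_zero_left hbal, abs_neg]
  have hbint : |graphIntegral μ b| ≤ M' * vol := by
    rw [graphIntegral, hvol, Finset.mul_sum]
    refine (Finset.abs_sum_le_sum_abs _ _).trans (Finset.sum_le_sum fun x _ => ?_)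
    rw [abs_mul, abs_of_pos (hμ x), mul_comm]
    exact mul_le_mul_of_nonneg_right (hbM' x) (hμ x).le
  have hSle : S ≤ M' * vol / |lam| := by
    rw [le_div_iff₀ hlam0]
    nlinarith [le_abs_self S]
  have hexp : ∀ x, Real.exp (u x) ≤ A := by
    intro x
    have h1 : μ x * (Real.exp (u x) * (Real.exp (u x) - 1)) ≤ S + vol / 4 := by
      have h2 : S + vol / 4
          = ∑ y, μ y * (Real.exp (u y) * (Real.exp (u y) - 1) + 1 / 4) := by
        rw [hS, hvol, Finset.sum_div, ← Finset.sum_add_distrib]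
        exact Finset.sum_congr rfl fun y _ => by ring
      have h3 := Finset.single_le_sum
        (f := fun y => μ y * (Real.exp (u y) * (Real.exp (u y) - 1) + 1 / 4))
        (fun y _ => mul_nonneg (hμ y).le (by linarith [neg_quarter_le_exp_mul (u y)]))
        (Finset.mem_univ x)
      rw [h2]
      refine le_trans ?_ h3
      simp only [mul_add]
      have := hμ x
      linarith
    by_contra! hcon
    have h4 : A - 2 < Real.exp (u x) * (Real.exp (u x) - 1) := by nlinarith
    have h5 : (A - 2) * μ x₁ = M' * vol / |lam| + vol / 4 := by
      rw [hA]; field_simp; ring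
    have h6 : (A - 2) * μ x₁ < μ x * (Real.exp (u x) * (Real.exp (u x) - 1)) := by
      nlinarith [hx₁ x, hμ x]
    linarith
  have hlap : ∀ x, |graphLaplacian G μ w u x| ≤ B := by
    intro x
    have he0 := Real.exp_pos (u x)
    have h1 : |Real.exp (u x) * (Real.exp (u x) - 1)| ≤ A ^ 2 := by
      rw [abs_le]
      constructor <;> nlinarith [hexp x, neg_quarter_le_exp_mul (u x)]
    have h2 : graphLaplacian G μ w u x
        = τ * (lam * (Real.exp (u x) * (Real.exp (u x) - 1)) + b x) := by
      linear_combination -hu x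
    rw [h2, abs_mul, abs_of_nonneg hτ.1]
    have h3 : |lam * (Real.exp (u x) * (Real.exp (u x) - 1)) + b x| ≤ B := by
      refine (abs_add_le _ _).trans (add_le_add ?_ (hbM' x))
      rw [abs_mul]
      exact mul_le_mul_of_nonneg_left h1 hlam0.le
    nlinarith [hτ.2, abs_nonneg (lam * (Real.exp (u x) * (Real.exp (u x) - 1)) + b x)]
  have hosc := hC u B hlap
  have hlow : ∃ x, η ≤ Real.exp (u x) := by
    by_contra! hcon
    have h1 : |S| < vol * (η * A) := by
      rw [hS, hvol, Finset.sum_mul]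
      refine (Finset.abs_sum_le_sum_abs _ _).trans_lt (Finset.sum_lt_sum_of_nonempty
        Finset.univ_nonempty fun x _ => ?_)
      have he0 := Real.exp_pos (u x)
      rw [abs_mul, abs_of_pos (hμ x), abs_mul, abs_of_pos he0]
      refine mul_lt_mul_of_pos_left ?_ (hμ x)
      have h2 : |Real.exp (u x) - 1| ≤ A := abs_le.2 ⟨by linarith, by linarith [hexp x]⟩
      exact (mul_le_mul_of_nonneg_left h2 he0.le).trans_lt
        (mul_lt_mul_of_pos_right (hcon x) (by linarith))
    have h2 : |lam| * (vol * (η * A)) = c := by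
      rw [hη]; field_simp
    have h3 := mul_lt_mul_of_pos_left h1 hlam0
    linarith
  obtain ⟨x₀, hx₀⟩ := hlow
  have hx₀' : Real.log η ≤ u x₀ := (Real.log_le_iff_le_exp hη0).2 hx₀
  have hCB : 0 ≤ C * B := (abs_nonneg _).trans (hosc x₀)
  refine (pi_norm_lt_iff (by positivity)).2 fun x => ?_
  have h1 := abs_le.1 (hosc x)
  have h2 := abs_le.1 (hosc x₀)
  have h3 := Real.add_one_le_exp (u x)
  have h4 := neg_abs_le (Real.log η)
  have h5 := abs_nonneg (Real.log η)
  rw [Real.norm_eq_abs, abs_lt]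
  constructor <;> linarith [hexp x]

theorem contDiff_chernSimonsMap (lam : ℝ) (f : V → ℝ) :
    ContDiff ℝ ∞ (chernSimonsMap G μ w lam f) := by
  refine contDiff_pi.2 fun x => ?_
  unfold chernSimonsMap graphLaplacian
  fun_prop

/-- The degree vanishes if `λ` and `∫ f` have the same sign: along `f + t λ` no solution escapes,
and at `t = 1` there is none, because `e^u (e^u - 1) ≥ -1/4`. -/
theorem exists_hasBrouwerDegree_zero (hG : G.Connected) (hμ : ∀ x, 0 < μ x)
    (hw_pos : ∀ x y, G.Adj x y → 0 < w x y) (hw_symm : ∀ x y, G.Adj x y → w x y = w y x)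
    {lam : ℝ} {f : V → ℝ} (hlf : 0 < lam * graphIntegral μ f) :
    ∃ R₀ : ℝ, 0 < R₀ ∧ ∀ R : ℝ, R₀ ≤ R →
      HasBrouwerDegree (chernSimonsMap G μ w lam f) (Metric.ball (0 : V → ℝ) R) 0 0 := by
  have := hG.nonempty
  have hvol0 : 0 < ∑ x, μ x := sum_measure_pos hμ
  have hlam : lam ≠ 0 := left_ne_zero_of_mul hlf.ne'
  have hf0 : graphIntegral μ f ≠ 0 := right_ne_zero_of_mul hlf.ne'
  obtain ⟨R₀, hR₀, hbound⟩ := exists_norm_lt_of_solution hG hμ hw_pos hw_symm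
    (M := ‖f‖ + |lam|) hlam (abs_pos.2 hf0)
  refine ⟨R₀, hR₀, fun R hR => ?_⟩
  have hR0 : R ≠ 0 := (hR₀.trans_le hR).ne'
  have hint : ∀ t : ℝ, graphIntegral μ (fun x => f x + t * lam)
      = graphIntegral μ f + t * lam * ∑ x, μ x := by
    intro t
    simp only [graphIntegral, mul_add, Finset.sum_add_distrib, ← Finset.sum_mul]
    ring
  have hbal : ∀ (b u : V → ℝ), chernSimonsMap G μ w lam b u = 0 →
      graphIntegral μ (fun x => lam * Real.exp (u x) * (Real.exp (u x) - 1) + b x) = 0 := by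
    intro b u hu
    have := graphMean_add_eq_zero (τ := 1) (σ := 0) hμ hw_symm (u := u)
      (v := fun x => lam * Real.exp (u x) * (Real.exp (u x) - 1) + b x)
      (fun x => by
        have := congrFun hu x
        simp only [chernSimonsMap, Pi.zero_apply] at this
        linarith)
    rw [one_mul, add_zero, graphMean_apply] at this
    exact (div_eq_zero_iff.1 this).resolve_right hvol0.ne'
  have hnone : ∀ u, chernSimonsMap G μ w lam (fun x => f x + lam) u ≠ 0 := by
    intro u hu
    have h1 := hbal _ u hu
    have h2 : graphIntegral μ (fun x => lam * Real.exp (u x) * (Real.exp (u x) - 1) + (f x + lam))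
        = lam * (∑ x, μ x * (Real.exp (u x) * (Real.exp (u x) - 1) + 1)) + graphIntegral μ f := by
      simp only [graphIntegral, Finset.mul_sum, ← Finset.sum_add_distrib]
      exact Finset.sum_congr rfl fun x _ => by ring
    have h3 : 0 ≤ ∑ x, μ x * (Real.exp (u x) * (Real.exp (u x) - 1) + 1) :=
      Finset.sum_nonneg fun x _ => mul_nonneg (hμ x).le
        (by linarith [neg_quarter_le_exp_mul (u x)])
    rw [h2] at h1
    have h4 : lam * lam * ∑ x, μ x * (Real.exp (u x) * (Real.exp (u x) - 1) + 1)
        + lam * graphIntegral μ f = 0 := by linear_combination lam * h1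
    linarith [mul_nonneg (mul_self_nonneg lam) h3]
  refine hasBrouwerDegree_of_homotopy Metric.isOpen_ball Metric.isBounded_ball
    (contDiff_chernSimonsMap lam f) (contDiff_chernSimonsMap lam fun x => f x + lam) ?_
    (fun x _ hx => absurd hx (hnone x)) ?_
  · intro t ht z hz h0
    rw [frontier_ball _ hR0, mem_sphere_zero_iff_norm] at hz
    have h1 : chernSimonsMap G μ w lam (fun x => f x + t * lam) z = 0 := by
      rw [← h0]
      ext x
      simp only [chernSimonsMap, Pi.add_apply, Pi.smul_apply, Pi.sub_apply, smul_eq_mul]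
      ring
    have h2 := hbound 1 (by simp) (fun x => f x + t * lam) (fun x => ?_) ?_ z (fun x => ?_)
      (hbal _ z h1)
    · linarith
    · refine (abs_add_le _ _).trans (add_le_add (norm_le_pi_norm f x) ?_)
      rw [abs_mul, abs_of_nonneg ht.1]
      exact mul_le_of_le_one_left (abs_nonneg _) ht.2
    · -- The two summands of the integral have the same sign.
      rw [hint, ← sq_le_sq]
      nlinarith [mul_nonneg (mul_nonneg ht.1 hlf.le) hvol0.le, sq_nonneg (t * lam * ∑ x, μ x)]
    · have := congrFun h1 x
      simp only [chernSimonsMap, Pi.zero_apply] at this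
      linarith
  · have : {x | x ∈ Metric.ball (0 : V → ℝ) R ∧
        chernSimonsMap G μ w lam (fun x => f x + lam) x = 0} = ∅ := by
      ext u
      simp [hnone u]
    rw [this, finsum_mem_empty]

variable (G μ w) in
/-- The map `u ↦ -Δu + c`, where `c` is the mean value of `λ e^u (e^u - 1) + f`. -/
noncomputable def averagedMap (lam : ℝ) (f u : V → ℝ) : V → ℝ := fun x =>
  -graphLaplacian G μ w u x
    + graphMean μ fun y => lam * Real.exp (u y) * (Real.exp (u y) - 1) + f y

theorem contDiff_averagedMap (lam : ℝ) (f : V → ℝ) : ContDiff ℝ ∞ (averagedMap G μ w lam f) := by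
  refine contDiff_pi.2 fun x => ?_
  simp only [averagedMap, graphMean_apply, graphLaplacian, graphIntegral]
  fun_prop

theorem averagedMap_eq_zero_iff (hG : G.Connected) (hμ : ∀ x, 0 < μ x)
    (hw_pos : ∀ x y, G.Adj x y → 0 < w x y) (hw_symm : ∀ x y, G.Adj x y → w x y = w y x)
    {lam : ℝ} {f u : V → ℝ} : averagedMap G μ w lam f u = 0 ↔
      ∃ s : ℝ, (u = fun _ => s) ∧ lam * Real.exp s * (Real.exp s - 1) + graphMean μ f = 0 := by
  have := hG.nonempty
  have hmean : ∀ s : ℝ, graphMean μ (fun y => lam * Real.exp s * (Real.exp s - 1) + f y)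
      = lam * Real.exp s * (Real.exp s - 1) + graphMean μ f := fun s => by
    have := map_add (graphMean μ) (fun _ => lam * Real.exp s * (Real.exp s - 1)) f
    rwa [graphMean_const hμ] at this
  constructor
  · intro h
    have hx : ∀ x, -graphLaplacian G μ w u x
        + graphMean μ (fun y => lam * Real.exp (u y) * (Real.exp (u y) - 1) + f y) = 0 :=
      fun x => congrFun h x
    have hm := graphMean_add_eq_zero (v := 0) (τ := 0) hμ hw_symm (u := u)
      (fun x => by simpa using hx x)
    rw [zero_mul, zero_add] at hm
    have hc := eq_of_graphLaplacian_eq_zero hG hμ hw_pos hw_symm (u := u)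
      (fun x => by simpa [hm] using hx x)
    obtain ⟨x₀⟩ := hG.nonempty
    have hu : u = fun _ => u x₀ := funext fun y => hc y x₀
    refine ⟨u x₀, hu, ?_⟩
    rw [hu] at hm
    exact (hmean _).symm.trans hm
  · rintro ⟨s, rfl, hs⟩
    ext x
    simp [averagedMap, graphLaplacian_const, hmean, hs]

theorem fderiv_averagedMap_const (lam : ℝ) (f : V → ℝ) (s : ℝ) :
    (fderiv ℝ (averagedMap G μ w lam f) (fun _ => s) : (V → ℝ) →ₗ[ℝ] (V → ℝ))
      = negLaplacianAddMean G μ w (lam * Real.exp s * (2 * Real.exp s - 1)) := by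
  have h : HasFDerivAt (averagedMap G μ w lam f)
      (negLaplacianAddMean G μ w (lam * Real.exp s * (2 * Real.exp s - 1))).toContinuousLinearMap
      (fun _ => s) := by
    have hN : HasFDerivAt
        (fun (u : V → ℝ) (y : V) => lam * Real.exp (u y) * (Real.exp (u y) - 1) + f y)
        ((lam * Real.exp s * (2 * Real.exp s - 1)) • ContinuousLinearMap.id ℝ (V → ℝ))
        (fun _ => s) := by
      refine hasFDerivAt_pi'.2 fun y => ?_
      have h1 : HasDerivAt (fun r : ℝ => lam * Real.exp r * (Real.exp r - 1) + f y)
          (lam * Real.exp s * (2 * Real.exp s - 1)) s := by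
        refine ((((Real.hasDerivAt_exp s).const_mul lam).mul
          ((Real.hasDerivAt_exp s).sub_const 1)).add_const (f y)).congr_deriv ?_
        ring
      have h2 := h1.comp_hasFDerivAt (fun _ : V => s) (hasFDerivAt_apply (𝕜 := ℝ) y (fun _ : V => s))
      refine h2.congr_fderiv ?_
      ext v
      simp
    refine hasFDerivAt_pi'.2 fun x => ?_
    have h1 : HasFDerivAt (fun u : V → ℝ => -graphLaplacian G μ w u x)
        (-((LinearMap.proj x).comp (laplacianLinearMap G μ w)).toContinuousLinearMap)
        (fun _ => s) :=
      ((LinearMap.proj x).comp (laplacianLinearMap G μ w)).toContinuousLinearMap.hasFDerivAt.neg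
    have h2 := h1.add
      ((graphMean μ).toContinuousLinearMap.hasFDerivAt.comp (fun _ : V => s) hN)
    refine h2.congr_fderiv ?_
    ext v
    simp [negLaplacianAddMean]
  rw [h.fderiv]
  rfl

/-- If `λ` and `∫ f` have opposite signs, the degree is the sign of `λ`: replacing the nonlinearity
by its mean value leaves a single zero, which is a constant. -/
theorem exists_hasBrouwerDegree_sign (hG : G.Connected) (hμ : ∀ x, 0 < μ x)
    (hw_pos : ∀ x y, G.Adj x y → 0 < w x y) (hw_symm : ∀ x y, G.Adj x y → w x y = w y x)
    {lam : ℝ} {f : V → ℝ} (hlf : lam * graphIntegral μ f < 0) :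
    ∃ R₀ : ℝ, 0 < R₀ ∧ ∀ R : ℝ, R₀ ≤ R →
      HasBrouwerDegree (chernSimonsMap G μ w lam f) (Metric.ball (0 : V → ℝ) R) 0
        (SignType.sign lam) := by
  have := hG.nonempty
  have hvol0 : 0 < ∑ x, μ x := sum_measure_pos hμ
  have hlam : lam ≠ 0 := left_ne_zero_of_mul hlf.ne
  have hf0 : graphIntegral μ f ≠ 0 := right_ne_zero_of_mul hlf.ne
  obtain ⟨R₀, hR₀, hbound⟩ := exists_norm_lt_of_solution hG hμ hw_pos hw_symm
    (M := ‖f‖) hlam (abs_pos.2 hf0)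
  refine ⟨R₀, hR₀, fun R hR => ?_⟩
  have hR0 : R ≠ 0 := (hR₀.trans_le hR).ne'
  have hnorm : ∀ t ∈ Icc (0 : ℝ) 1, ∀ z, chernSimonsMap G μ w lam f z
      + t • (averagedMap G μ w lam f z - chernSimonsMap G μ w lam f z) = 0 → ‖z‖ < R := by
    intro t ht z h0
    set N : V → ℝ := fun x => lam * Real.exp (z x) * (Real.exp (z x) - 1) + f x with hN
    have h1 : ∀ x, -graphLaplacian G μ w z x + (1 - t) * N x + t * graphMean μ N = 0 := by
      intro x
      have := congrFun h0 x
      simp only [chernSimonsMap, averagedMap, Pi.add_apply, Pi.smul_apply, Pi.sub_apply,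
        smul_eq_mul, Pi.zero_apply] at this
      simp only [hN]
      linear_combination this
    have h2 : graphMean μ N = 0 := by
      have := graphMean_add_eq_zero hμ hw_symm h1
      linear_combination this
    refine (hbound (1 - t) ⟨by linarith [ht.2], by linarith [ht.1]⟩ f (norm_le_pi_norm f) le_rfl z
      (fun x => ?_) ((div_eq_zero_iff.1 h2).resolve_right hvol0.ne')).trans_le hR
    have := h1 x
    rw [h2, mul_zero, add_zero] at this
    exact this
  -- The zero of the averaged map is the constant `log a`, `a` the positive root of `a (a - 1) = q`.
  set q := -(graphMean μ f) / lam with hq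
  have hq0 : 0 < q := by
    have h1 : q = -(lam * graphIntegral μ f) / (lam ^ 2 * ∑ x, μ x) := by
      rw [hq, graphMean_apply]; field_simp
    rw [h1]
    exact div_pos (by linarith) (by positivity)
  obtain ⟨a, ha1, haq⟩ : ∃ a : ℝ, 1 < a ∧ a * (a - 1) = q := by
    refine ⟨(1 + √(1 + 4 * q)) / 2, ?_, ?_⟩
    · have : 1 < √(1 + 4 * q) := Real.lt_sqrt_of_sq_lt (by linarith)
      linarith
    · have := Real.sq_sqrt (by linarith : 0 ≤ 1 + 4 * q)
      linear_combination this / 4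
  have ha0 : 0 < a := by linarith
  have hlq : lam * q = -graphMean μ f := by rw [hq]; field_simp
  have hzero : ∀ u, averagedMap G μ w lam f u = 0 ↔ u = fun _ => Real.log a := by
    intro u
    rw [averagedMap_eq_zero_iff hG hμ hw_pos hw_symm]
    constructor
    · rintro ⟨s, rfl, hs⟩
      have h1 : lam * ((Real.exp s - a) * (Real.exp s + a - 1)) = 0 := by
        linear_combination hs - hlq - lam * haq
      -- The other root `1 - a` of the quadratic is negative.
      have h2 : Real.exp s = a := by
        rcases mul_eq_zero.1 ((mul_eq_zero.1 h1).resolve_left hlam) with h | h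
        · linarith
        · linarith [Real.exp_pos s]
      rw [← h2, Real.log_exp]
    · rintro rfl
      refine ⟨Real.log a, rfl, ?_⟩
      rw [Real.exp_log ha0]
      linear_combination lam * haq + hlq
  have hset : {u | u ∈ Metric.ball (0 : V → ℝ) R ∧ averagedMap G μ w lam f u = 0}
      = {fun _ => Real.log a} := by
    ext u
    simp only [mem_ofPred_eq, mem_singleton_iff, hzero, and_iff_right_iff_imp]
    intro hu
    rw [mem_ball_zero_iff]
    refine hnorm 1 (by simp) u ?_
    rw [one_smul, add_sub_cancel]
    exact (hzero u).2 hu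
  have hsign : SignType.sign (fderiv ℝ (averagedMap G μ w lam f) fun _ => Real.log a).det
      = SignType.sign lam := by
    rw [ContinuousLinearMap.det, fderiv_averagedMap_const, Real.exp_log ha0,
      det_negLaplacianAddMean hμ, mul_assoc, mul_assoc, sign_mul, sign_pos (a := a * _), mul_one]
    exact mul_pos ha0 (mul_pos (by linarith)
      (det_negLaplacianAddMean_one_pos hG hμ hw_pos hw_symm))
  refine hasBrouwerDegree_of_homotopy Metric.isOpen_ball Metric.isBounded_ball
    (contDiff_chernSimonsMap lam f) (contDiff_averagedMap (G := G) (μ := μ) (w := w) lam f)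
    ?_ ?_ ?_
  · intro t ht z hz h0
    rw [frontier_ball _ hR0, mem_sphere_zero_iff_norm] at hz
    exact (hnorm t ht z h0).ne hz
  · intro u _ hu
    rw [(hzero u).1 hu, ← sign_ne_zero, hsign]
    exact sign_ne_zero.2 hlam
  · rw [hset, finsum_mem_singleton, hsign]

end Bounds

theorem theorem2 {V : Type*} [Fintype V] (G : SimpleGraph V) [DecidableRel G.Adj]
    (hG : G.Connected)
    (μ : V → ℝ) (hμ : ∀ x, 0 < μ x)
    (w : V → V → ℝ) (hw_pos : ∀ x y, G.Adj x y → 0 < w x y)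
    (hw_symm : ∀ x y, G.Adj x y → w x y = w y x)
    (lam : ℝ) (f : V → ℝ) (hlf : lam * graphIntegral μ f ≠ 0) :
    ∃ R₀ : ℝ, 0 < R₀ ∧ ∀ R : ℝ, R₀ ≤ R →
      (0 < lam ∧ graphIntegral μ f < 0 →
        HasBrouwerDegree (chernSimonsMap G μ w lam f) (Metric.ball (0 : V → ℝ) R) 0 1) ∧
      (0 < lam * graphIntegral μ f →
        HasBrouwerDegree (chernSimonsMap G μ w lam f) (Metric.ball (0 : V → ℝ) R) 0 0) ∧
      (lam < 0 ∧ 0 < graphIntegral μ f →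
        HasBrouwerDegree (chernSimonsMap G μ w lam f) (Metric.ball (0 : V → ℝ) R) 0 (-1)) := by
  rcases lt_or_gt_of_ne hlf with h | h
  · obtain ⟨R₀, hR₀, hdeg⟩ := exists_hasBrouwerDegree_sign hG hμ hw_pos hw_symm h
    refine ⟨R₀, hR₀, fun R hR => ⟨fun h' => ?_, fun h' => absurd h' h.not_gt, fun h' => ?_⟩⟩
    · simpa [sign_pos h'.1] using hdeg R hR
    · simpa [sign_neg h'.1] using hdeg R hR
  · obtain ⟨R₀, hR₀, hdeg⟩ := exists_hasBrouwerDegree_zero hG hμ hw_pos hw_symm h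
    refine ⟨R₀, hR₀, fun R hR => ⟨fun h' => ?_, fun _ => hdeg R hR, fun h' => ?_⟩⟩
    · exact absurd h (mul_neg_of_pos_of_neg h'.1 h'.2).not_gt
    · exact absurd h (mul_neg_of_neg_of_pos h'.1 h'.2).not_gt
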